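/- Let $s\ge 1$ and let $\boldsymbol p=(p_1,\dots,p_s)$ be a vector of $s$ mutually different primes. For $n=n_0+n_1p+n_2p^2+\cdots$ in base $p$ let $\phi_p(n)=\sum_{r\ge 0} n_r p^{-r-1}$ be the radical inverse, and let $\boldsymbol x_n=(\phi_{p_1}(n),\dots,\phi_{p_s}(n))$, $n\ge 0$, be the Halton sequence in bases $\boldsymbol p$. Extend $\phi_p$ to the $p$-adic integers by $\phi_p(\sum_{r\ge0} z_rp^r)=\sum_{r\ge0} z_rp^{-r-1} \pmod 1\in[0,1)$, and let $\phi_p^+:[0,1)\to\mathbb Z_p$, $\phi_p^+(\sum_{r\ge0} x_rp^{-r-1})=\sum_{r\ge0} x_rp^r$, where the finite expansion is used for $p$-adic rationals. For $\boldsymbol\sigma\in[0,1)^s$ let $\mathcal H_{\boldsymbol p,\boldsymbol\sigma}$ be the $\boldsymbol p$-adically shifted Halton sequence, whose $n$-th point has coordinates $\phi_{p_j}(\phi_{p_j}^+(x_{n,j})+\phi_{p_j}^+(\sigma_j))$, $1\le j\le s$, with addition in $\mathbb Z_{p_j}$. For a sequence $\mathcal S=(\boldsymbol y_n)_{n\ge0}$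 in $[0,1)^s$ and $N\ge1$ let $$\Delta_N(\boldsymbol t)=\frac1N\,\#\{0\le n<N:\boldsymbol y_n\in[\boldsymbol 0,\boldsymbol t)\}-\prod_{i=1}^s t_i ,\qquad L_{2,N}(\mathcal S)=\Big(\sum_{\emptyset\ne u\subseteq\{1,\dots,s\}}\int_{[0,1]^{|u|}}|\Delta_N(\boldsymbol t_u,\boldsymbol 1)|^2\,d\boldsymbol t_u\Big)^{1/2},$$ where $(\boldsymbol t_u,\boldsymbol 1)$ has all coordinates outside $u$ equal to $1$ (the $L_2$-discrepancy with all weights equal to $1$). Let $$\widehat L_{2,N}(\mathcal H_{\boldsymbol p})=\Big(\int_{[0,1)^s}L_{2,N}(\mathcal H_{\boldsymbol p,\boldsymbol\sigma})^2\,d\boldsymbol\sigma\Big)^{1/2}$$ be the root mean square $L_2$-discrepancy of the shifted Halton sequence; for every $N\ge1$ the integrand is integrable. (1) There is a constant $C>0$, depending only on $s$ and the bases $\boldsymbol p$, such that for all $N\ge 2$ $$\widehat L_{2,N}(\mathcal H_{\boldsymbol p})\le C\,\frac{(\log N)^{s/2}}{N},$$ and, for every $N\ge2$, there is a shift $\boldsymbol\sigma_*\in[0,1)^s$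 (depending on $N$) with $$L_{2,N}(\mathcal H_{\boldsymbol p,\boldsymbol\sigma_*})\le C\,\frac{(\log N)^{s/2}}{N}.$$ (2) The order of magnitude in $N$ is best possible: there is a constant $c>0$ depending only on $s$ such that every sequence $\mathcal S$ in $[0,1)^s$ satisfies $L_{2,N}(\mathcal S)\ge c\,(\log N)^{s/2}/N$ for infinitely many $N$ (Proinov's bound), and likewise $\widehat L_{2,N}(\mathcal H_{\boldsymbol p})\ge c\,(\log N)^{s/2}/N$ for infinitely many $N$, for all vectors $\boldsymbol p$ of $s$ mutually different primes. -/

import Mathlib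

open MeasureTheory

noncomputable section

/-- The half-open unit cube `[0,1)^s`. -/
def unitCube (s : ℕ) : Set (Fin s → ℝ) :=
  Set.univ.pi fun _ => Set.Ico (0 : ℝ) 1

/-! ### Halton sequences -/

/-- The radical inverse `n₀ / p + n₁ / p² + ⋯` of `n = n₀ + n₁ p + n₂ p² + ⋯` in base `p`. -/
def radicalInverse (p n : ℕ) : ℝ :=
  ∑' k : ℕ, ((n / p ^ k % p : ℕ) : ℝ) / (p : ℝ) ^ (k + 1)

/-- The Halton sequence `(x_n)_{n ≥ 0}` in bases `p₁, …, p_s`. -/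
def halton {s : ℕ} (p : Fin s → ℕ) (n : ℕ) : Fin s → ℝ :=
  fun j => radicalInverse (p j) n

/-! ### `p`-adic shifts -/

/-- The digit `z_r ∈ {0, …, p - 1}` in the expansion `z = ∑ z_r p^r` of a `p`-adic integer.
Here `z.appr m` is the representative of `z` modulo `p^m` in `{0, …, p^m - 1}`, that is,
the partial sum of the first `m` terms. -/
def padicDigit (p : ℕ) [Fact p.Prime] (z : ℤ_[p]) (r : ℕ) : ℕ :=
  z.appr (r + 1) / p ^ r

/-- The Monna map `ℤ_p → [0,1)`, `∑ z_r p^r ↦ ∑ z_r / p^(r+1) (mod 1)`. -/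
def monna (p : ℕ) [Fact p.Prime] (z : ℤ_[p]) : ℝ :=
  Int.fract (∑' r : ℕ, (padicDigit p z r : ℝ) / (p : ℝ) ^ (r + 1))

/-- The digit `x_r` in the expansion `x = ∑ x_r / p^(r+1)` of `x ∈ [0,1)`; the expansion is the
finite one if `x` is a `p`-adic rational. -/
def realDigit (p : ℕ) (x : ℝ) (r : ℕ) : ℕ :=
  ⌊x * (p : ℝ) ^ (r + 1)⌋₊ % p

/-- The map `[0,1) → ℤ_p`, `∑ x_r / p^(r+1) ↦ ∑ x_r p^r`. -/
def monnaInv (p : ℕ) [Fact p.Prime] (x : ℝ) : ℤ_[p] :=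
  ∑' r : ℕ, (realDigit p x r : ℤ_[p]) * (p : ℤ_[p]) ^ r

/-- The coordinatewise `p`-adic shift `x ⊕ σ` of `x ∈ [0,1)^s` by `σ ∈ [0,1)^s`. -/
def padicShift {s : ℕ} (p : Fin s → ℕ) [∀ j, Fact (p j).Prime] (x σ : Fin s → ℝ) :
    Fin s → ℝ :=
  fun j => monna (p j) (monnaInv (p j) (x j) + monnaInv (p j) (σ j))

/-- The `p`-adically shifted Halton sequence `(x_n ⊕ σ)_{n ≥ 0}`. -/
def shiftedHalton {s : ℕ} (p : Fin s → ℕ) [∀ j, Fact (p j).Prime] (σ : Fin s → ℝ) (n : ℕ) :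
    Fin s → ℝ :=
  padicShift p (halton p n) σ

/-! ### `L₂`-discrepancy -/

/-- The local discrepancy `Δ_N(t)` of the first `N` points `x_0, …, x_{N-1}` of a sequence. -/
def localDiscrepancy {s : ℕ} (x : ℕ → Fin s → ℝ) (N : ℕ) (t : Fin s → ℝ) : ℝ :=
  (1 / (N : ℝ)) * ∑ n ∈ Finset.range N,
      (Set.univ.pi fun i => Set.Ico 0 (t i)).indicator (fun _ => (1 : ℝ)) (x n)
    - ∏ i, t i

/-- The point `(t_u, 1)`, whose coordinates outside `u` are replaced by `1`. -/
def extendByOne {s : ℕ} (u : Finset (Fin s)) (t : u → ℝ) : Fin s → ℝ :=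
  fun j => if h : j ∈ u then t ⟨j, h⟩ else 1

/-- The weighted `L₂`-discrepancy of the first `N` points of a sequence, with weights `γ`. -/
def weightedL2Discrepancy {s : ℕ} (γ : Fin s → ℝ) (x : ℕ → Fin s → ℝ) (N : ℕ) : ℝ :=
  Real.sqrt (∑ u : Finset (Fin s) with u.Nonempty,
    (∏ j ∈ u, γ j) * ∫ t in Set.Icc (0 : u → ℝ) 1, |localDiscrepancy x N (extendByOne u t)| ^ 2)

/-- The `L₂`-discrepancy for the weights `γ_j = 1`. -/
def l2Discrepancy {s : ℕ} (x : ℕ → Fin s → ℝ) (N : ℕ) : ℝ :=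
  weightedL2Discrepancy (fun _ => 1) x N

/-- The root mean square `L₂`-discrepancy of the shifted Halton sequence: the shift `σ` is uniformly
distributed on `[0,1)^s`. -/
def rmsL2Discrepancy {s : ℕ} (p : Fin s → ℕ) [∀ j, Fact (p j).Prime] (N : ℕ) : ℝ :=
  Real.sqrt (∫ σ in unitCube s, l2Discrepancy (shiftedHalton p σ) N ^ 2)

end

/-! Upper bound. To `G` digits, the shifted Halton point of index `n` is given in coordinate `j` by
the residue of `n + z_j` modulo `p_j ^ G`. For a uniform shift the `z_j` are independent and uniform
(`appr_monnaInv_radicalInverse_add`, `integral_comp_realTrunc`). The conditional expectation of the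
indicator of `[0, t_j)` given these digits telescopes into martingale differences. Multiplying over
`j` writes the local discrepancy, up to truncation, as a sum over level vectors `g ≠ 0` in `{0, …,
G}^s`; the vector `0` contributes exactly the volume (`sum_prod_condInterval_sub`). Sums with
different `g` are orthogonal in the mean over the shift (`integral_haltonDiffSum_mul`). Each is
bounded by `∏ p_j`, uniformly in `N` (`abs_sum_prod_intervalDiff_le`): full periods cancel, and by
the Chinese remainder theorem the nonzero terms lie in one sparse residue class. So the mean square
of `N * Δ_N` is of order at most `(G + 1) ^ s`. Taking `2 ^ G ≥ N ^ 2` with `G` of order `log N`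
makes the truncation error bounded.

Lower bound. This is Roth's method in dimension `s + 1`, with the index `n` as time coordinate. For
every choice of dyadic side lengths the boxes are twice as many as the points, so at least half of
them are empty. On an empty box the Haar coefficient of the discrepancy comes from the volume term
alone and has a fixed size. Bessel's inequality bounds the sum over `τ < 2 ^ m` from below by a
multiple of `m ^ s * 2 ^ m` (`le_sum_integral_sq_countDiscrepancy`). The bound holds for every
sequence, hence also after integration over the shift, and it is incompatible with only finitely
many large values (`infinite_setOf_le_of_le_sum`). -/

/-! ### Digit reversal and martingale differences -/

/-- The number whose base `p` digits are the first `g` digits of `z` in reversed order. -/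
def digitRev (p : ℕ) : ℕ → ℕ → ℕ
  | 0, _ => 0
  | g + 1, z => p * digitRev p g z + z / p ^ g % p

theorem div_pow_mod_congr {p g z z' r : ℕ} (h : z ≡ z' [MOD p ^ g]) (hr : r < g) :
    z / p ^ r % p = z' / p ^ r % p := by
  have h2 : z ≡ z' [MOD p ^ r * p] := by
    rw [← pow_succ]
    exact h.of_dvd (pow_dvd_pow p hr)
  rw [← Nat.mod_mul_right_div_self, ← Nat.mod_mul_right_div_self, h2]

theorem digitRev_congr {p g z z' : ℕ} (h : z ≡ z' [MOD p ^ g]) :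
    digitRev p g z = digitRev p g z' := by
  induction g with
  | zero => rfl
  | succ g ih =>
    simp only [digitRev]
    rw [ih (h.of_dvd (pow_dvd_pow p g.le_succ)), div_pow_mod_congr h g.lt_succ_self]

theorem digitRev_succ_div {p : ℕ} (hp : 0 < p) (g z : ℕ) :
    digitRev p (g + 1) z / p = digitRev p g z := by
  simp only [digitRev]
  rw [Nat.mul_add_div hp, Nat.div_eq_of_lt (Nat.mod_lt _ hp), add_zero]

theorem digitRev_succ_mod (p g z : ℕ) :
    digitRev p (g + 1) z % p = z / p ^ g % p := by
  simp only [digitRev]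
  rw [Nat.mul_add_mod, Nat.mod_mod]

theorem digitRev_add_div {p : ℕ} (hp : 0 < p) (g j z : ℕ) :
    digitRev p (g + j) z / p ^ j = digitRev p g z := by
  induction j with
  | zero => simp
  | succ j ih =>
    rw [pow_succ', ← Nat.div_div_eq_div_mul, ← add_assoc, digitRev_succ_div hp, ih]

theorem digitRev_lt {p : ℕ} (hp : 0 < p) (g z : ℕ) : digitRev p g z < p ^ g := by
  induction g with
  | zero => simp [digitRev]
  | succ g ih =>
    simp only [digitRev, pow_succ']
    have h1 := Nat.mod_lt (z / p ^ g) hp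
    calc p * digitRev p g z + z / p ^ g % p < p * digitRev p g z + p := by omega
      _ = p * (digitRev p g z + 1) := by ring
      _ ≤ p * p ^ g := Nat.mul_le_mul_left _ ih

theorem modEq_of_digitRev_eq {p : ℕ} (hp : 0 < p) {g z z' : ℕ}
    (h : digitRev p g z = digitRev p g z') : z ≡ z' [MOD p ^ g] := by
  induction g with
  | zero => simp [Nat.modEq_one]
  | succ g ih =>
    have h1 : z ≡ z' [MOD p ^ g] := by
      apply ih; rw [← digitRev_succ_div hp, h, digitRev_succ_div hp]
    have h2 : z / p ^ g % p = z' / p ^ g % p := by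
      rw [← digitRev_succ_mod, h, digitRev_succ_mod]
    unfold Nat.ModEq at *
    rw [Nat.mod_pow_succ, Nat.mod_pow_succ, h1, h2]

/-! ### Conditional expectations of interval indicators. -/

/-- Truncation of a real number to `[0,1]`. -/
noncomputable def clampUnit (x : ℝ) : ℝ := max 0 (min 1 x)

theorem clampUnit_nonneg (x : ℝ) : 0 ≤ clampUnit x := le_max_left _ _

theorem clampUnit_le_one (x : ℝ) : clampUnit x ≤ 1 := max_le zero_le_one (min_le_left _ _)

theorem clampUnit_of_nonpos {x : ℝ} (h : x ≤ 0) : clampUnit x = 0 := by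
  rw [clampUnit, min_eq_right (by linarith), max_eq_left h]

theorem clampUnit_of_one_le {x : ℝ} (h : 1 ≤ x) : clampUnit x = 1 := by
  rw [clampUnit, min_eq_left h, max_eq_right zero_le_one]

theorem clampUnit_of_mem {x : ℝ} (h0 : 0 ≤ x) (h1 : x ≤ 1) : clampUnit x = x := by
  rw [clampUnit, min_eq_right h1, max_eq_right h0]

/-- `clampUnit (x - e)` is the length of `[0, x) ∩ [e, e + 1)`, and these lengths add up. -/
theorem sum_clampUnit_sub (x : ℝ) (n : ℕ) :
    ∑ e ∈ Finset.range n, clampUnit (x - e) = max 0 (min (n : ℝ) x) := by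
  induction n with
  | zero => simp
  | succ n ih =>
    rw [Finset.sum_range_succ, ih, clampUnit]
    have hn : (0 : ℝ) ≤ n := n.cast_nonneg
    push_cast
    rcases le_total x n with h | h
    · rw [min_eq_right h, min_eq_right (by linarith : x - n ≤ 1), max_eq_left (by linarith : x - n ≤ 0),
        min_eq_right (by linarith), add_zero]
    · rw [min_eq_left h, max_eq_right hn, max_eq_right (le_min zero_le_one (by linarith)),
        max_eq_right (le_min (by linarith) (by linarith)), ← min_add_add_left, add_sub_cancel]

/-- The conditional expectation of the indicator function of `[0,t)` given the first `g` digits. -/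
noncomputable def condInterval (p : ℕ) (t : ℝ) (g z : ℕ) : ℝ :=
  clampUnit (t * (p : ℝ) ^ g - digitRev p g z)

/-- The martingale differences of `condInterval`. -/
noncomputable def intervalDiff (p : ℕ) (t : ℝ) : ℕ → ℕ → ℝ
  | 0, z => condInterval p t 0 z
  | g + 1, z => condInterval p t (g + 1) z - condInterval p t g z

theorem sum_intervalDiff (p : ℕ) (t : ℝ) (G z : ℕ) :
    ∑ g ∈ Finset.range (G + 1), intervalDiff p t g z = condInterval p t G z := by
  induction G with
  | zero => simp [intervalDiff]
  | succ G ih => rw [Finset.sum_range_succ, ih, intervalDiff]; ring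

theorem intervalDiff_zero (p : ℕ) {t : ℝ} (h0 : 0 ≤ t) (h1 : t ≤ 1) (z : ℕ) :
    intervalDiff p t 0 z = t := by
  simp [intervalDiff, condInterval, digitRev, clampUnit_of_mem h0 h1]

theorem condInterval_congr {p : ℕ} {t : ℝ} {g z z' : ℕ} (h : z ≡ z' [MOD p ^ g]) :
    condInterval p t g z = condInterval p t g z' := by
  rw [condInterval, condInterval, digitRev_congr h]

theorem intervalDiff_congr {p : ℕ} {t : ℝ} {g z z' : ℕ} (h : z ≡ z' [MOD p ^ g]) :
    intervalDiff p t g z = intervalDiff p t g z' := by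
  cases g with
  | zero => exact condInterval_congr h
  | succ g =>
    simp only [intervalDiff]
    rw [condInterval_congr h, condInterval_congr (h.of_dvd (pow_dvd_pow p g.le_succ))]

theorem abs_intervalDiff_le_one (p : ℕ) (t : ℝ) (g z : ℕ) : |intervalDiff p t g z| ≤ 1 := by
  cases g with
  | zero =>
    simp only [intervalDiff, condInterval]
    rw [abs_of_nonneg (clampUnit_nonneg _)]
    exact clampUnit_le_one _
  | succ g =>
    simp only [intervalDiff, condInterval]
    rw [abs_le]
    constructor <;>
      linarith [clampUnit_nonneg (t * (p : ℝ) ^ g - digitRev p g z),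
        clampUnit_le_one (t * (p : ℝ) ^ g - digitRev p g z),
        clampUnit_nonneg (t * (p : ℝ) ^ (g + 1) - digitRev p (g + 1) z),
        clampUnit_le_one (t * (p : ℝ) ^ (g + 1) - digitRev p (g + 1) z)]

/-- A cell of order `g` lying entirely on one side of `t` has conditional expectation `0` or `1`,
and so have its subcells. Only the cell containing `t` can contribute, which is a single residue
class modulo `p ^ g`. -/
theorem digitRev_eq_of_intervalDiff_ne_zero {p : ℕ} (hp : 0 < p) {t : ℝ} {g z : ℕ}
    (h : intervalDiff p t (g + 1) z ≠ 0) : digitRev p g z = ⌊t * (p : ℝ) ^ g⌋₊ := by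
  by_contra hne
  apply h
  have hd : ((z / p ^ g % p : ℕ) : ℝ) + 1 ≤ p := by exact_mod_cast Nat.mod_lt _ hp
  have hd0 : (0 : ℝ) ≤ ((z / p ^ g % p : ℕ) : ℝ) := Nat.cast_nonneg _
  have hp1 : (1 : ℝ) ≤ p := by exact_mod_cast hp
  have hr : (digitRev p (g + 1) z : ℝ) = p * digitRev p g z + ((z / p ^ g % p : ℕ) : ℝ) := by
    simp only [digitRev]; push_cast; rfl
  simp only [intervalDiff, condInterval]
  rw [hr]
  rcases le_or_gt (t * (p : ℝ) ^ g) (digitRev p g z) with h1 | h1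
  · rw [clampUnit_of_nonpos (by rw [pow_succ]; nlinarith), clampUnit_of_nonpos (by linarith), sub_zero]
  · have h2 : (digitRev p g z : ℝ) + 1 ≤ t * (p : ℝ) ^ g := by
      by_contra h3
      push Not at h3
      exact hne (((Nat.floor_eq_iff ((Nat.cast_nonneg _).trans h1.le)).2 ⟨h1.le, h3⟩).symm)
    rw [clampUnit_of_one_le (by rw [pow_succ]; nlinarith), clampUnit_of_one_le (by linarith), sub_self]

/-- A unit `c` modulo `p` permutes the residues. The factor `c` is needed later for steps that must
also be multiples of the moduli of the other bases. -/
theorem sum_range_add_mul_mod {p c : ℕ} (hp : 0 < p) (hc : c.Coprime p) (a : ℕ) (F : ℕ → ℝ) :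
    ∑ k ∈ Finset.range p, F ((a + c * k) % p) = ∑ e ∈ Finset.range p, F e := by
  have hinj : Set.InjOn (fun k => (a + c * k) % p) (Finset.range p) := by
    intro k hk l hl h
    have h1 : c * k ≡ c * l [MOD p] := Nat.ModEq.add_left_cancel' a h
    have h2 : k ≡ l [MOD p] := Nat.ModEq.cancel_left_of_coprime (Nat.coprime_comm.1 hc) h1
    simp only [Finset.coe_range, Set.mem_Iio] at hk hl
    rwa [Nat.ModEq, Nat.mod_eq_of_lt hk, Nat.mod_eq_of_lt hl] at h2
  have himg : (Finset.range p).image (fun k => (a + c * k) % p) = Finset.range p := by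
    apply Finset.eq_of_subset_of_card_le
    · intro x hx
      obtain ⟨k, -, rfl⟩ := Finset.mem_image.1 hx
      exact Finset.mem_range.2 (Nat.mod_lt _ hp)
    · rw [Finset.card_image_of_injOn hinj]
  conv_rhs => rw [← himg, Finset.sum_image hinj]

/-- The martingale property: steps of `p ^ g * c` keep the first `g` digits and run the next digit
through all its values. -/
theorem sum_condInterval_succ {p c : ℕ} (hp : 0 < p) (hc : c.Coprime p) (t : ℝ) (g z : ℕ) :
    ∑ k ∈ Finset.range p, condInterval p t (g + 1) (z + p ^ g * c * k) = p * condInterval p t g z := by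
  have h1 : ∀ k, condInterval p t (g + 1) (z + p ^ g * c * k) =
      (fun e : ℕ => clampUnit ((t * (p : ℝ) ^ (g + 1) - p * digitRev p g z) - e))
        ((z / p ^ g + c * k) % p) := by
    intro k
    have h2 : digitRev p g (z + p ^ g * c * k) = digitRev p g z := by
      apply digitRev_congr
      simp [Nat.ModEq, mul_assoc]
    have h3 : (z + p ^ g * c * k) / p ^ g = z / p ^ g + c * k := by
      rw [mul_assoc, Nat.add_mul_div_left _ _ (pow_pos hp g)]
    simp only [condInterval, digitRev, h2, h3]
    push_cast
    ring_nf
  simp_rw [h1]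
  rw [sum_range_add_mul_mod hp hc (z / p ^ g) fun e : ℕ =>
    clampUnit ((t * (p : ℝ) ^ (g + 1) - p * digitRev p g z) - e), sum_clampUnit_sub, condInterval, clampUnit]
  have hp0 : (0 : ℝ) ≤ p := p.cast_nonneg
  rw [mul_max_of_nonneg _ _ hp0, mul_min_of_nonneg _ _ hp0, mul_zero, mul_one]
  congr 2
  ring

theorem sum_intervalDiff_succ {p c : ℕ} (hp : 0 < p) (hc : c.Coprime p) (t : ℝ) (g z : ℕ) :
    ∑ k ∈ Finset.range p, intervalDiff p t (g + 1) (z + p ^ g * c * k) = 0 := by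
  simp only [intervalDiff]
  rw [Finset.sum_sub_distrib, sum_condInterval_succ hp hc]
  have : ∀ k, condInterval p t g (z + p ^ g * c * k) = condInterval p t g z := fun k =>
    condInterval_congr (by simp [Nat.ModEq, mul_assoc])
  simp [this]

/-! ### Sums of periodic functions -/

theorem Function.Periodic.sum_range_add {Φ : ℕ → ℝ} {M : ℕ} (h : Function.Periodic Φ M) (a : ℕ) :
    ∑ n ∈ Finset.range M, Φ (n + a) = ∑ n ∈ Finset.range M, Φ n := by
  induction a with
  | zero => rfl
  | succ a ih =>
    rw [← ih]
    have h1 := Finset.sum_range_succ (fun n => Φ (n + a)) M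
    have h2 := Finset.sum_range_succ' (fun n => Φ (n + a)) M
    have h3 : Φ (M + a) = Φ (0 + a) := by rw [add_comm M a, h a, zero_add]
    have h4 : ∑ n ∈ Finset.range M, Φ (n + (a + 1)) = ∑ n ∈ Finset.range M, Φ (n + 1 + a) :=
      Finset.sum_congr rfl fun n _ => by rw [add_assoc, add_comm a 1]
    rw [h4]
    linarith

/-- A sum over a full period is invariant under translation, so it may be averaged over the `p`
translates before summing. -/
theorem Function.Periodic.sum_range_eq_zero {Φ : ℕ → ℝ} {M c p : ℕ} (h : Function.Periodic Φ M)
    (hp : 0 < p) (h0 : ∀ n, ∑ k ∈ Finset.range p, Φ (n + c * k) = 0) :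
    ∑ n ∈ Finset.range M, Φ n = 0 := by
  have h1 : (p : ℝ) * ∑ n ∈ Finset.range M, Φ n = 0 := by
    calc (p : ℝ) * ∑ n ∈ Finset.range M, Φ n
        = ∑ k ∈ Finset.range p, ∑ n ∈ Finset.range M, Φ (n + c * k) := by
          simp_rw [h.sum_range_add]; simp
      _ = 0 := by rw [Finset.sum_comm]; exact Finset.sum_eq_zero fun n _ => h0 n
  have hp' : (p : ℝ) ≠ 0 := by exact_mod_cast hp.ne'
  exact (mul_eq_zero.1 h1).resolve_left hp'

theorem Function.Periodic.sum_range_eq_sum_range_mod {Φ : ℕ → ℝ} {M : ℕ}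
    (h : Function.Periodic Φ M) (h0 : ∑ n ∈ Finset.range M, Φ n = 0) (N : ℕ) :
    ∑ n ∈ Finset.range N, Φ n = ∑ n ∈ Finset.range (N % M), Φ n := by
  have key : ∀ q r : ℕ, ∑ n ∈ Finset.range (r + q * M), Φ n = ∑ n ∈ Finset.range r, Φ n := by
    intro q
    induction q with
    | zero => intro r; simp
    | succ q ih =>
      intro r
      rw [← ih r, Nat.succ_mul, ← add_assoc, Finset.sum_range_add]
      simp_rw [add_comm (r + q * M)]
      rw [h.sum_range_add, h0, add_zero]
  conv_lhs => rw [← Nat.mod_add_div' N M]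
  exact key _ _

/-! ### Orthogonality, and boundedness along the diagonal. -/

/-- Martingale differences of different levels are orthogonal, also after translation. -/
theorem sum_intervalDiff_mul_intervalDiff {p : ℕ} (hp : 0 < p) (t : ℝ) {g g' G : ℕ}
    (hgg : g ≠ g') (hg : g ≤ G) (hg' : g' ≤ G) (n n' : ℕ) :
    ∑ r ∈ Finset.range (p ^ G), intervalDiff p t g (n + r) * intervalDiff p t g' (n' + r) = 0 := by
  wlog hlt : g < g' generalizing g g' n n'
  · rw [← this hgg.symm hg' hg n' n (by omega)]
    exact Finset.sum_congr rfl fun r _ => mul_comm _ _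
  obtain ⟨e, rfl⟩ : ∃ e, g' = e + 1 := ⟨g' - 1, by omega⟩
  have hper : ∀ f ≤ G, ∀ a r : ℕ, intervalDiff p t f (a + (r + p ^ G)) =
      intervalDiff p t f (a + r) := fun f hf a r => by
    apply intervalDiff_congr
    obtain ⟨k, hk⟩ := pow_dvd_pow p hf
    rw [hk, ← add_assoc]
    simp [Nat.ModEq]
  refine Function.Periodic.sum_range_eq_zero (c := p ^ e) (fun r => ?_) hp fun r => ?_
  · simp only [hper g hg, hper _ hg']
  -- Since `g ≤ e`, steps of `p ^ e` do not change the factor of lower level; it comes out of the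
  -- sum, and the factor of level `e + 1` sums to zero.
  · have h1 : ∀ k, intervalDiff p t g (n + (r + p ^ e * k)) = intervalDiff p t g (n + r) := fun k => by
      apply intervalDiff_congr
      obtain ⟨k', hk⟩ := pow_dvd_pow p (show g ≤ e by omega)
      rw [hk, ← add_assoc, mul_assoc]
      simp [Nat.ModEq]
    simp_rw [h1]
    rw [← Finset.mul_sum]
    have := sum_intervalDiff_succ hp (Nat.coprime_one_left p) t e (n' + r)
    simp only [mul_one] at this
    simp_rw [← add_assoc]
    rw [this, mul_zero]

/-- Sums of products of martingale differences along the diagonal are uniformly bounded. -/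
theorem abs_sum_prod_intervalDiff_le {s : ℕ} {p : Fin s → ℕ} (hp : ∀ j, (p j).Prime)
    (hinj : Function.Injective p) (t : Fin s → ℝ) {g : Fin s → ℕ} (hg : g ≠ 0) (z : Fin s → ℕ)
    (N : ℕ) :
    |∑ n ∈ Finset.range N, ∏ j, intervalDiff (p j) (t j) (g j) (n + z j)| ≤ ∏ j, (p j : ℝ) := by
  set h : ℕ → ℝ := fun n => ∏ j, intervalDiff (p j) (t j) (g j) (n + z j) with hh
  set P : ℕ := ∏ j, p j ^ g j with hP
  -- A factor of level `g j ≥ 1` prescribes the residue modulo `p j ^ (g j - 1)`. For `g j = 0` the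
  -- truncated subtraction gives modulus `1`, that is, no condition.
  set Q : ℕ := ∏ j, p j ^ (g j - 1) with hQ
  have hcop : ∀ i j, i ≠ j → (p i).Coprime (p j) := fun i j hij =>
    (Nat.coprime_primes (hp i) (hp j)).2 fun h => hij (hinj h)
  have hQpos : 0 < Q := Finset.prod_pos fun j _ => pow_pos (hp j).pos _
  have hPpos : 0 < P := Finset.prod_pos fun j _ => pow_pos (hp j).pos _
  have hdvd : ∀ j, p j ^ g j ∣ P := fun j => Finset.dvd_prod_of_mem _ (Finset.mem_univ j)
  have hPQ : P ≤ (∏ j, p j) * Q := by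
    rw [hP, hQ, ← Finset.prod_mul_distrib]
    refine Finset.prod_le_prod' fun j _ => ?_
    rw [← pow_succ']
    exact Nat.pow_le_pow_right (hp j).pos (by omega)
  have hper : Function.Periodic h P := fun n => by
    refine Finset.prod_congr rfl fun j _ => intervalDiff_congr ?_
    obtain ⟨k, hk⟩ := hdvd j
    rw [hk, add_right_comm]
    simp [Nat.ModEq]
  have hzero : ∑ n ∈ Finset.range P, h n = 0 := by
    obtain ⟨i, hi⟩ := Function.ne_iff.1 hg
    obtain ⟨e, he⟩ : ∃ e, g i = e + 1 := ⟨g i - 1, by have : g i ≠ 0 := hi; omega⟩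
    -- Steps that are multiples of `R` leave all coordinates other than `i` unchanged, and `R` is a
    -- unit modulo `p i`.
    set R : ℕ := ∏ j ∈ Finset.univ.erase i, p j ^ g j with hR
    have hRc : R.Coprime (p i) := Nat.Coprime.prod_left fun j hj =>
      (hcop j i (Finset.ne_of_mem_erase hj)).pow_left _
    refine hper.sum_range_eq_zero (c := p i ^ e * R) (hp i).pos fun n => ?_
    have h1 : ∀ k, h (n + p i ^ e * R * k) =
        (∏ j ∈ Finset.univ.erase i, intervalDiff (p j) (t j) (g j) (n + z j)) *
          intervalDiff (p i) (t i) (e + 1) (n + z i + p i ^ e * R * k) := by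
      intro k
      rw [hh]
      simp only
      rw [← Finset.prod_erase_mul _ _ (Finset.mem_univ i), he]
      congr 1
      · refine Finset.prod_congr rfl fun j hj => intervalDiff_congr ?_
        obtain ⟨k', hk⟩ : p j ^ g j ∣ R := Finset.dvd_prod_of_mem _ hj
        rw [hk, show n + p i ^ e * (p j ^ g j * k') * k + z j =
          n + z j + p j ^ g j * (p i ^ e * k' * k) by ring]
        simp [Nat.ModEq]
      · congr 1; ring
    simp_rw [h1]
    rw [← Finset.mul_sum, sum_intervalDiff_succ (hp i).pos hRc, mul_zero]
  rw [hper.sum_range_eq_sum_range_mod hzero]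
  have hle : ∀ n, |h n| ≤ 1 := fun n => by
    rw [hh]; simp only
    rw [Finset.abs_prod]
    exact Finset.prod_le_one (fun _ _ => abs_nonneg _) fun _ _ => abs_intervalDiff_le_one _ _ _ _
  -- By coprimality the conditions in the separate bases combine into one residue class modulo `Q`.
  have hclass : ∀ n n', h n ≠ 0 → h n' ≠ 0 → n ≡ n' [MOD Q] := by
    intro n n' hn hn'
    rw [hh] at hn hn'
    have hn1 := Finset.prod_ne_zero_iff.1 hn
    have hn2 := Finset.prod_ne_zero_iff.1 hn'
    rw [Nat.modEq_iff_dvd, hQ, Nat.cast_prod]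
    refine Finset.prod_dvd_of_coprime (fun i _ j _ hij => ?_) fun j _ => ?_
    · exact (Nat.Coprime.isCoprime ((hcop i j hij).pow _ _))
    · rw [← Nat.modEq_iff_dvd]
      rcases Nat.eq_zero_or_pos (g j) with h0 | h0
      · rw [h0]; simp [Nat.modEq_one]
      · obtain ⟨e, he⟩ : ∃ e, g j = e + 1 := ⟨g j - 1, by omega⟩
        have h1 := hn1 j (Finset.mem_univ j)
        have h2 := hn2 j (Finset.mem_univ j)
        rw [he] at h1 h2
        have h3 := (digitRev_eq_of_intervalDiff_ne_zero (hp j).pos h1).trans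
          (digitRev_eq_of_intervalDiff_ne_zero (hp j).pos h2).symm
        rw [he, Nat.add_sub_cancel]
        exact Nat.ModEq.add_right_cancel' (z j) (modEq_of_digitRev_eq (hp j).pos h3)
  -- Fewer than `P` consecutive indices remain, and one class modulo `Q` has at most `P / Q ≤ ∏ p j`
  -- members among them.
  have hcard : ((Finset.range (N % P)).filter fun n => h n ≠ 0).card ≤ ∏ j, p j := by
    have hmaps : ∀ n ∈ (Finset.range (N % P)).filter fun n => h n ≠ 0,
        n / Q ∈ Finset.range (∏ j, p j) := by
      intro n hn
      rw [Finset.mem_filter, Finset.mem_range] at hn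
      rw [Finset.mem_range, Nat.div_lt_iff_lt_mul hQpos]
      exact (hn.1.trans (Nat.mod_lt _ hPpos)).trans_le hPQ
    refine (Finset.card_le_card_of_injOn (fun n => n / Q) hmaps ?_).trans (Finset.card_range _).le
    intro n hn n' hn' hnn
    have h1 := hclass n n' (Finset.mem_filter.1 hn).2 (Finset.mem_filter.1 hn').2
    simp only at hnn
    rw [← Nat.mod_add_div n Q, ← Nat.mod_add_div n' Q, hnn, h1]
  calc |∑ n ∈ Finset.range (N % P), h n|
      = |∑ n ∈ (Finset.range (N % P)).filter fun n => h n ≠ 0, h n| := by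
        rw [Finset.sum_filter_ne_zero]
    _ ≤ ∑ n ∈ (Finset.range (N % P)).filter fun n => h n ≠ 0, |h n| := Finset.abs_sum_le_sum_abs _ _
    _ ≤ ∑ n ∈ (Finset.range (N % P)).filter fun n => h n ≠ 0, 1 := Finset.sum_le_sum fun n _ => hle n
    _ ≤ ∏ j, (p j : ℝ) := by
        rw [Finset.sum_const, nsmul_one]
        exact_mod_cast hcard

/-! ### Truncations of real and `p`-adic expansions -/

/-- The natural number formed by the first `G` digits of `x` in reversed order. -/
noncomputable def realTrunc (p G : ℕ) (x : ℝ) : ℕ :=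
  ∑ r ∈ Finset.range G, realDigit p x r * p ^ r

theorem realTrunc_lt {p : ℕ} (hp : 0 < p) (G : ℕ) (x : ℝ) : realTrunc p G x < p ^ G := by
  induction G with
  | zero => simp [realTrunc]
  | succ G ih =>
    rw [realTrunc, Finset.sum_range_succ, ← realTrunc]
    have h1 : realDigit p x G + 1 ≤ p := Nat.mod_lt _ hp
    calc realTrunc p G x + realDigit p x G * p ^ G < p ^ G + realDigit p x G * p ^ G := by omega
      _ = (realDigit p x G + 1) * p ^ G := by ring
      _ ≤ p * p ^ G := Nat.mul_le_mul_right _ h1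
      _ = p ^ (G + 1) := (pow_succ' _ _).symm

/-- Reversing the digits twice recovers the index of the cell of length `p ^ (-G)` containing `x`;
it is exact because `realDigit` is defined by floors. -/
theorem digitRev_realTrunc {p : ℕ} (hp : 0 < p) (G : ℕ) {x : ℝ} (hx : x ∈ Set.Ico (0 : ℝ) 1) :
    digitRev p G (realTrunc p G x) = ⌊x * (p : ℝ) ^ G⌋₊ := by
  induction G with
  | zero => simp [digitRev, Nat.floor_eq_zero.2 hx.2]
  | succ G ih =>
    have h1 : realTrunc p (G + 1) x = realTrunc p G x + p ^ G * realDigit p x G := by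
      rw [realTrunc, Finset.sum_range_succ, ← realTrunc, mul_comm (p ^ G)]
    have h2 : digitRev p G (realTrunc p (G + 1) x) = ⌊x * (p : ℝ) ^ G⌋₊ := by
      rw [← ih, h1]
      exact digitRev_congr (by simp [Nat.ModEq])
    have h3 : realTrunc p (G + 1) x / p ^ G % p = realDigit p x G := by
      rw [h1, Nat.add_mul_div_left _ _ (pow_pos hp G), Nat.div_eq_of_lt (realTrunc_lt hp G x),
        zero_add]
      exact Nat.mod_mod _ _
    have h4 : ⌊x * (p : ℝ) ^ (G + 1)⌋₊ / p = ⌊x * (p : ℝ) ^ G⌋₊ := by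
      rw [← Nat.floor_div_natCast, pow_succ, ← mul_assoc,
        mul_div_cancel_right₀ _ (by exact_mod_cast hp.ne')]
    rw [digitRev, h2, h3, ← h4, realDigit, Nat.div_add_mod]

/-! ### Finitely many digits of `p`-adic integers, and the Monna map. -/

section
variable (p : ℕ) [hp : Fact p.Prime]

theorem appr_eq_mod_of_dvd_sub {z : ℤ_[p]} {n G : ℕ} (h : (p : ℤ_[p]) ^ G ∣ z - n) :
    z.appr G = n % p ^ G := by
  have h1 : (p : ℤ_[p]) ^ G ∣ z - z.appr G := Ideal.mem_span_singleton.1 (PadicInt.appr_spec G z)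
  have h2 : (p : ℤ_[p]) ^ G ∣ ((n : ℤ) - (z.appr G : ℤ) : ℤ) := by
    have := dvd_sub h1 h
    push_cast
    convert this using 1
    ring
  rw [PadicInt.pow_p_dvd_int_iff] at h2
  have h3 : z.appr G ≡ n [MOD p ^ G] := (Nat.modEq_iff_dvd).2 (by exact_mod_cast h2)
  rw [← h3, Nat.mod_eq_of_lt (PadicInt.appr_lt z G)]

/-- Every term of the tail is divisible by `p ^ G`. Expressed as a norm bound, this passes to the
infinite sum by the ultrametric inequality. -/
theorem dvd_monnaInv_sub_realTrunc (x : ℝ) (G : ℕ) :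
    (p : ℤ_[p]) ^ G ∣ monnaInv p x - realTrunc p G x := by
  have hs : Summable fun r : ℕ => (realDigit p x r : ℤ_[p]) * (p : ℤ_[p]) ^ r := by
    apply NonarchimedeanAddGroup.summable_of_tendsto_cofinite_zero
    rw [Nat.cofinite_eq_atTop]
    refine squeeze_zero_norm (a := fun r => ((p : ℝ)⁻¹) ^ r) (fun r => ?_) ?_
    · rw [norm_mul, norm_pow, PadicInt.norm_p]
      exact mul_le_of_le_one_left (by positivity) (PadicInt.norm_le_one _)
    · exact tendsto_pow_atTop_nhds_zero_of_lt_one (by positivity)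
        (inv_lt_one_of_one_lt₀ (by exact_mod_cast hp.1.one_lt))
  have h1 : monnaInv p x = realTrunc p G x +
      ∑' r : ℕ, (realDigit p x (r + G) : ℤ_[p]) * (p : ℤ_[p]) ^ (r + G) := by
    rw [monnaInv, ← hs.sum_add_tsum_nat_add G, realTrunc]
    push_cast
    rfl
  rw [h1, add_sub_cancel_left]
  have hs' := (summable_nat_add_iff G).2 hs
  have hterm : ∀ r, (p : ℤ_[p]) ^ G ∣ (realDigit p x (r + G) : ℤ_[p]) * (p : ℤ_[p]) ^ (r + G) :=
    fun r => (pow_dvd_pow _ (Nat.le_add_left G r)).mul_left _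
  rw [← Ideal.mem_span_singleton, ← PadicInt.norm_le_pow_iff_mem_span_pow]
  refine IsUltrametricDist.norm_tsum_le_of_forall_le_of_nonneg (by positivity) fun r => ?_
  rw [PadicInt.norm_le_pow_iff_mem_span_pow, Ideal.mem_span_singleton]
  exact hterm r

variable {p}

theorem appr_monnaInv_add (x y : ℝ) (G : ℕ) :
    (monnaInv p x + monnaInv p y).appr G = (realTrunc p G x + realTrunc p G y) % p ^ G := by
  apply appr_eq_mod_of_dvd_sub
  have := dvd_add (dvd_monnaInv_sub_realTrunc p x G) (dvd_monnaInv_sub_realTrunc p y G)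
  push_cast
  convert this using 1
  ring

theorem padicDigit_eq (z : ℤ_[p]) {r G : ℕ} (h : r < G) :
    padicDigit p z r = z.appr G / p ^ r % p := by
  have h1 : z.appr (r + 1) ≡ z.appr G [MOD p ^ (r + 1)] :=
    (Nat.modEq_iff_dvd' (PadicInt.appr_mono z h)).2 (PadicInt.dvd_appr_sub_appr z _ _ h)
  have h2 : z.appr (r + 1) / p ^ r < p := by
    rw [Nat.div_lt_iff_lt_mul (pow_pos hp.1.pos r), ← pow_succ']
    exact PadicInt.appr_lt z _
  rw [padicDigit, ← div_pow_mod_congr h1 r.lt_succ_self, Nat.mod_eq_of_lt h2]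

theorem sum_padicDigit (z : ℤ_[p]) (G : ℕ) :
    ∑ r ∈ Finset.range G, (padicDigit p z r : ℝ) / (p : ℝ) ^ (r + 1) =
      digitRev p G (z.appr G) / (p : ℝ) ^ G := by
  have hp0 : (p : ℝ) ≠ 0 := by exact_mod_cast hp.1.ne_zero
  induction G with
  | zero => simp [digitRev]
  | succ G ih =>
    have h1 : z.appr G ≡ z.appr (G + 1) [MOD p ^ G] :=
      (Nat.modEq_iff_dvd' (PadicInt.appr_mono z G.le_succ)).2
        (PadicInt.dvd_appr_sub_appr z _ _ G.le_succ)
    rw [Finset.sum_range_succ, ih, padicDigit_eq z G.lt_succ_self, digitRev, digitRev_congr h1]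
    push_cast
    field_simp
    ring

theorem tsum_padicDigit_mem (z : ℤ_[p]) (G : ℕ) :
    (∑' r : ℕ, (padicDigit p z r : ℝ) / (p : ℝ) ^ (r + 1)) ∈
      Set.Icc ((digitRev p G (z.appr G) : ℝ) / (p : ℝ) ^ G)
        ((digitRev p G (z.appr G) + 1 : ℝ) / (p : ℝ) ^ G) := by
  have hp1 : (1 : ℝ) < p := by exact_mod_cast hp.1.one_lt
  have hp0 : (0 : ℝ) < p := by linarith
  have hnn : ∀ r, 0 ≤ (padicDigit p z r : ℝ) / (p : ℝ) ^ (r + 1) := fun r => by positivity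
  have hd : ∀ r, (padicDigit p z r : ℝ) + 1 ≤ p := fun r => by
    rw [padicDigit_eq z r.lt_succ_self]
    exact_mod_cast Nat.mod_lt _ hp.1.pos
  -- A digit is at most `p - 1`, so a partial sum plus the largest possible tail `1 / p ^ G`
  -- decreases with `G`.
  have hanti : Antitone fun G => ∑ r ∈ Finset.range G, (padicDigit p z r : ℝ) / (p : ℝ) ^ (r + 1) +
      1 / (p : ℝ) ^ G := by
    refine antitone_nat_of_succ_le fun n => ?_
    have h1 : (padicDigit p z n : ℝ) / (p : ℝ) ^ (n + 1) + 1 / (p : ℝ) ^ (n + 1) ≤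
        1 / (p : ℝ) ^ n := by
      rw [← add_div, div_le_div_iff₀ (by positivity) (by positivity), pow_succ' (p : ℝ) n, one_mul]
      exact mul_le_mul_of_nonneg_right (hd n) (by positivity)
    rw [Finset.sum_range_succ]
    linarith
  have hbound : ∀ n, ∑ r ∈ Finset.range n, (padicDigit p z r : ℝ) / (p : ℝ) ^ (r + 1) ≤
      ∑ r ∈ Finset.range G, (padicDigit p z r : ℝ) / (p : ℝ) ^ (r + 1) + 1 / (p : ℝ) ^ G := by
    intro n
    rcases le_total n G with h | h
    · exact (Finset.sum_le_sum_of_subset_of_nonneg (Finset.range_mono h) fun _ _ _ => hnn _).trans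
        (le_add_of_nonneg_right (by positivity))
    · exact (le_add_of_nonneg_right (by positivity)).trans (hanti h)
  have hs : Summable fun r : ℕ => (padicDigit p z r : ℝ) / (p : ℝ) ^ (r + 1) :=
    summable_of_sum_range_le hnn hbound
  constructor
  · rw [← sum_padicDigit]
    exact hs.sum_le_tsum _ fun _ _ => hnn _
  · rw [add_div, ← sum_padicDigit]
    exact Real.tsum_le_of_sum_range_le hnn hbound

theorem monna_nonneg (z : ℤ_[p]) : 0 ≤ monna p z := Int.fract_nonneg _

/-- Outside the last cell the series is less than `1`, so reduction modulo `1` does nothing. The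
cell is closed on the right since a tail of digits `p - 1` reaches its endpoint. -/
theorem monna_mem_Icc (z : ℤ_[p]) {G : ℕ} (h : digitRev p G (z.appr G) + 1 ≠ p ^ G) :
    monna p z ∈ Set.Icc ((digitRev p G (z.appr G) : ℝ) / (p : ℝ) ^ G)
        ((digitRev p G (z.appr G) + 1 : ℝ) / (p : ℝ) ^ G) := by
  have hp0 : (0 : ℝ) < p := by exact_mod_cast hp.1.pos
  have h1 := tsum_padicDigit_mem z G
  have h2 : digitRev p G (z.appr G) + 1 < p ^ G :=
    lt_of_le_of_ne (digitRev_lt hp.1.pos _ _) h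
  rw [monna, Int.fract_eq_self.2]
  · exact h1
  · refine ⟨le_trans (by positivity) h1.1, h1.2.trans_lt ?_⟩
    rw [div_lt_one (by positivity)]
    exact_mod_cast h2

/-- Away from two residue classes, the indicator function of `[0,t)` is determined by the first
`G` digits. -/
theorem indicator_monna_eq (z : ℤ_[p]) {t : ℝ} {G : ℕ}
    (h : digitRev p G (z.appr G) + 1 ≠ p ^ G)
    (h' : digitRev p G (z.appr G) + 1 ≠ ⌈t * (p : ℝ) ^ G⌉₊) :
    (Set.Ico 0 t).indicator (fun _ => (1 : ℝ)) (monna p z) = condInterval p t G (z.appr G) := by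
  have hp0 : (0 : ℝ) < (p : ℝ) ^ G := by have := hp.1.pos; positivity
  obtain ⟨h1, h2⟩ := monna_mem_Icc z h
  rw [div_le_iff₀ hp0] at h1
  rw [le_div_iff₀ hp0] at h2
  -- The closed cell lies either strictly to the left of `t` or at and beyond `t`. The excluded cell
  -- is the one with left endpoint `< t ≤` right endpoint; equality must be excluded because only
  -- the closed cell is known.
  rcases lt_or_gt_of_ne h' with h3 | h3
  · have h4 := Nat.lt_ceil.1 h3
    push_cast at h4
    rw [Set.indicator_of_mem, condInterval, clampUnit_of_one_le (by linarith)]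
    exact ⟨monna_nonneg z, lt_of_mul_lt_mul_right (h2.trans_lt h4) hp0.le⟩
  · have h4 := Nat.ceil_le.1 (Nat.lt_succ_iff.1 h3)
    rw [Set.indicator_of_notMem, condInterval, clampUnit_of_nonpos (by linarith)]
    exact fun h5 => absurd h5.2 (not_lt.2 (le_of_mul_le_mul_right (h4.trans h1) hp0))

end

/-! ### The radical inverse -/

theorem radicalInverse_eq {p : ℕ} (hp : 1 < p) {n K : ℕ} (hn : n < p ^ K) :
    radicalInverse p n = digitRev p K n / (p : ℝ) ^ K := by
  have hp0 : (p : ℝ) ≠ 0 := by exact_mod_cast (by omega : p ≠ 0)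
  have h1 : ∀ G, ∑ k ∈ Finset.range G, ((n / p ^ k % p : ℕ) : ℝ) / (p : ℝ) ^ (k + 1) =
      digitRev p G n / (p : ℝ) ^ G := by
    intro G
    induction G with
    | zero => simp [digitRev]
    | succ G ih =>
      rw [Finset.sum_range_succ, ih, digitRev, Nat.cast_add, Nat.cast_mul]
      field_simp
      ring
  rw [radicalInverse, ← h1, tsum_eq_sum]
  intro k hk
  rw [Finset.mem_range, not_lt] at hk
  rw [Nat.div_eq_of_lt (hn.trans_le (Nat.pow_le_pow_right (by omega) hk))]
  simp

theorem radicalInverse_mem_Ico {p : ℕ} (hp : 1 < p) (n : ℕ) :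
    radicalInverse p n ∈ Set.Ico (0 : ℝ) 1 := by
  have hp0 : (0 : ℝ) < p := by exact_mod_cast (by omega : 0 < p)
  rw [radicalInverse_eq hp (Nat.lt_pow_self hp)]
  refine ⟨by positivity, ?_⟩
  rw [div_lt_one (by positivity)]
  exact_mod_cast digitRev_lt (by omega) _ _

theorem realTrunc_radicalInverse_modEq {p : ℕ} (hp : 1 < p) (n G : ℕ) :
    realTrunc p G (radicalInverse p n) ≡ n [MOD p ^ G] := by
  have hp0 : (p : ℝ) ≠ 0 := by exact_mod_cast (by omega : p ≠ 0)
  apply modEq_of_digitRev_eq (by omega)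
  rw [digitRev_realTrunc (by omega) G (radicalInverse_mem_Ico hp n)]
  -- With `n` extra digits the expansion of `n` is complete; they are removed again by
  -- `digitRev_add_div`.
  have hn : n < p ^ (G + n) :=
    (Nat.lt_pow_self hp).trans_le (Nat.pow_le_pow_right (by omega) (Nat.le_add_left n G))
  rw [radicalInverse_eq hp hn, ← digitRev_add_div (by omega) G n n, ← Nat.floor_div_eq_div (K := ℝ)]
  congr 1
  push_cast
  rw [pow_add]
  field_simp

/-- In the first `G` digits the shift acts on the Halton sequence as a translation of the index. -/
theorem appr_monnaInv_radicalInverse_add {p : ℕ} [hp : Fact p.Prime] (n : ℕ) (y : ℝ) (G : ℕ) :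
    (monnaInv p (radicalInverse p n) + monnaInv p y).appr G = (n + realTrunc p G y) % p ^ G := by
  rw [appr_monnaInv_add]
  exact (realTrunc_radicalInverse_modEq hp.1.one_lt n G).add_right _

/-! ### The distribution of the truncation of a uniformly distributed real number -/

theorem realTrunc_eq_iff {p : ℕ} (hp : 0 < p) {G r : ℕ} (hr : r < p ^ G) {x : ℝ}
    (hx : x ∈ Set.Ico (0 : ℝ) 1) :
    realTrunc p G x = r ↔ x ∈ Set.Ico ((digitRev p G r : ℝ) / (p : ℝ) ^ G)
      ((digitRev p G r + 1 : ℝ) / (p : ℝ) ^ G) := by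
  have hp0 : (0 : ℝ) < (p : ℝ) ^ G := by positivity
  rw [Set.mem_Ico, div_le_iff₀ hp0, lt_div_iff₀ hp0,
    ← Nat.floor_eq_iff (mul_nonneg hx.1 hp0.le), ← digitRev_realTrunc hp G hx]
  refine ⟨fun h => by rw [h], fun h => ?_⟩
  have h1 := modEq_of_digitRev_eq hp h
  rwa [Nat.ModEq, Nat.mod_eq_of_lt (realTrunc_lt hp G x), Nat.mod_eq_of_lt hr] at h1

theorem measurable_realDigit (p r : ℕ) : Measurable fun x => realDigit p x r := by
  unfold realDigit
  have : Measurable fun n : ℕ => n % p := measurable_from_top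
  exact this.comp (Nat.measurable_floor.comp (measurable_id.mul_const _))

theorem measurable_realTrunc (p G : ℕ) : Measurable fun x => realTrunc p G x := by
  unfold realTrunc
  exact Finset.measurable_fun_sum _ fun r _ => (measurable_realDigit p r).mul_const _

/-- For uniform `x` the truncation is uniform on residues modulo `p ^ G`: each value is taken on one
cell of length `p ^ (-G)`. -/
theorem integral_comp_realTrunc {p : ℕ} (hp : 0 < p) (G : ℕ) (F : ℕ → ℝ) :
    ∫ x in Set.Ico (0 : ℝ) 1, F (realTrunc p G x) =
      (∑ r ∈ Finset.range (p ^ G), F r) / (p : ℝ) ^ G := by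
  have hp0 : (0 : ℝ) < (p : ℝ) ^ G := by positivity
  set I : ℕ → Set ℝ := fun r => Set.Ico ((digitRev p G r : ℝ) / (p : ℝ) ^ G)
      ((digitRev p G r + 1 : ℝ) / (p : ℝ) ^ G) with hI
  have h1 : ∀ x ∈ Set.Ico (0 : ℝ) 1, F (realTrunc p G x) =
      ∑ r ∈ Finset.range (p ^ G), (I r).indicator (fun _ => F r) x := by
    intro x hx
    rw [Finset.sum_eq_single_of_mem (realTrunc p G x) (Finset.mem_range.2 (realTrunc_lt hp G x)),
      Set.indicator_of_mem ((realTrunc_eq_iff hp (realTrunc_lt hp G x) hx).1 rfl)]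
    intro r hr hne
    rw [Set.indicator_of_notMem]
    exact fun h => hne ((realTrunc_eq_iff hp (Finset.mem_range.1 hr) hx).2 h).symm
  have hsub : ∀ r, I r ⊆ Set.Ico 0 1 := fun r => by
    refine Set.Ico_subset_Ico (by positivity) ?_
    rw [div_le_one hp0]
    exact_mod_cast digitRev_lt hp G r
  rw [setIntegral_congr_fun measurableSet_Ico h1, integral_finsetSum, Finset.sum_div]
  · refine Finset.sum_congr rfl fun r _ => ?_
    rw [setIntegral_indicator measurableSet_Ico, Set.inter_eq_right.2 (hsub r), setIntegral_const]
    rw [Real.volume_real_Ico_of_le (by gcongr; linarith), smul_eq_mul]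
    field_simp
    ring
  · intro r _
    exact (integrable_const _).indicator measurableSet_Ico

theorem integral_pi_Ico_prod {s : ℕ} (f : Fin s → ℝ → ℝ) :
    ∫ σ in unitCube s, ∏ j, f j (σ j) = ∏ j, ∫ x in Set.Ico (0 : ℝ) 1, f j x := by
  rw [unitCube, volume_pi, Measure.restrict_pi_pi]
  exact integral_fintype_prod_eq_prod _

/-! ### The mean square of the local discrepancy -/

theorem volume_unitCube (s : ℕ) : volume (unitCube s) = 1 := by
  simp [unitCube, volume_pi_pi]

theorem measurableSet_unitCube (s : ℕ) : MeasurableSet (unitCube s) :=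
  MeasurableSet.univ_pi fun _ => measurableSet_Ico

theorem volume_real_unitCube (s : ℕ) : volume.real (unitCube s) = 1 := by
  rw [Measure.real, volume_unitCube, ENNReal.toReal_one]

theorem integrableOn_unitCube {s : ℕ} {f : (Fin s → ℝ) → ℝ} (hf : Measurable f) {C : ℝ}
    (hC : ∀ σ, |f σ| ≤ C) : IntegrableOn f (unitCube s) :=
  Measure.integrableOn_of_bounded (by simp [volume_unitCube]) hf.aestronglyMeasurable
    (Filter.Eventually.of_forall hC)

theorem setIntegral_unitCube_le {s : ℕ} {f : (Fin s → ℝ) → ℝ} {C : ℝ} (hC : ∀ σ, |f σ| ≤ C) :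
    ∫ σ in unitCube s, f σ ≤ C := by
  have h := norm_setIntegral_le_of_norm_le_const (μ := volume) (s := unitCube s)
    (by simp [volume_unitCube]) (f := f) fun σ _ => (Real.norm_eq_abs _).trans_le (hC σ)
  rw [volume_real_unitCube, mul_one] at h
  exact (le_abs_self _).trans h

/-- Factors are exchanged one at a time. This reduces the truncation error of a box to those of its
sides. -/
theorem abs_prod_sub_prod_le_sum {ι : Type*} (S : Finset ι) {a b : ι → ℝ}
    (ha : ∀ i, |a i| ≤ 1) (hb : ∀ i, |b i| ≤ 1) :
    |∏ i ∈ S, a i - ∏ i ∈ S, b i| ≤ ∑ i ∈ S, |a i - b i| := by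
  classical
  induction S using Finset.induction_on with
  | empty => simp
  | insert i S hi ih =>
    rw [Finset.prod_insert hi, Finset.prod_insert hi, Finset.sum_insert hi]
    have h1 : |∏ i ∈ S, b i| ≤ 1 := by
      rw [Finset.abs_prod]
      exact Finset.prod_le_one (fun _ _ => abs_nonneg _) fun _ _ => hb _
    calc |a i * ∏ i ∈ S, a i - b i * ∏ i ∈ S, b i|
        = |a i * (∏ i ∈ S, a i - ∏ i ∈ S, b i) + (a i - b i) * ∏ i ∈ S, b i| := by ring_nf
      _ ≤ |a i| * |∏ i ∈ S, a i - ∏ i ∈ S, b i| + |a i - b i| * |∏ i ∈ S, b i| := by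
        rw [← abs_mul, ← abs_mul]; exact abs_add_le _ _
      _ ≤ 1 * |∏ i ∈ S, a i - ∏ i ∈ S, b i| + |a i - b i| * 1 := by
        gcongr
        exact ha i
      _ ≤ |a i - b i| + ∑ i ∈ S, |a i - b i| := by linarith

theorem indicator_pi_eq_prod {ι : Type*} [Fintype ι] (S : ι → Set ℝ) (x : ι → ℝ) :
    (Set.univ.pi S).indicator (fun _ => (1 : ℝ)) x =
      ∏ i, (S i).indicator (fun _ => (1 : ℝ)) (x i) := by
  classical
  simp only [Set.indicator_apply, Set.mem_univ_pi]
  split_ifs with h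
  · simp [h]
  · push Not at h
    obtain ⟨i, hi⟩ := h
    exact (Finset.prod_eq_zero (Finset.mem_univ i) (by simp [hi])).symm

theorem abs_indicator_one_le {α : Type*} (S : Set α) (x : α) :
    |S.indicator (fun _ => (1 : ℝ)) x| ≤ 1 := by
  by_cases h : x ∈ S <;> simp [h]

theorem natCast_mul_localDiscrepancy {s : ℕ} (x : ℕ → Fin s → ℝ) (N : ℕ) (t : Fin s → ℝ) :
    N * localDiscrepancy x N t =
      ∑ n ∈ Finset.range N, ∏ i, (Set.Ico 0 (t i)).indicator (fun _ => (1 : ℝ)) (x n i) -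
        N * ∏ i, t i := by
  rcases Nat.eq_zero_or_pos N with rfl | hN
  · simp
  · have : (N : ℝ) ≠ 0 := by exact_mod_cast hN.ne'
    simp only [localDiscrepancy, indicator_pi_eq_prod]
    field_simp

/-! ### Orthogonal expansion of the truncated discrepancy. -/

section
variable {s : ℕ} (p : Fin s → ℕ) (t : Fin s → ℝ)

/-- The sums of products of martingale differences along the truncated shifted Halton sequence. -/
noncomputable def haltonDiffSum (N G : ℕ) (g : Fin s → ℕ) (σ : Fin s → ℝ) : ℝ :=
  ∑ n ∈ Finset.range N, ∏ j, intervalDiff (p j) (t j) (g j) (n + realTrunc (p j) G (σ j))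

theorem measurable_comp_realTrunc (f : ℕ → ℝ) (p G : ℕ) :
    Measurable fun x => f (realTrunc p G x) :=
  (measurable_from_top (f := f)).comp (measurable_realTrunc p G)

theorem measurable_haltonDiffSum (N G : ℕ) (g : Fin s → ℕ) :
    Measurable (haltonDiffSum p t N G g) :=
  Finset.measurable_fun_sum _ fun n _ => Finset.measurable_fun_prod _ fun j _ =>
    (measurable_comp_realTrunc (fun z => intervalDiff (p j) (t j) (g j) (n + z)) (p j) G).comp
      (measurable_pi_apply j)

variable {p t}

/-- Each factor is a telescoping sum over levels. In the expanded product the level vector `0` gives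
the expected number of points. -/
theorem sum_prod_condInterval_sub (h0 : ∀ j, 0 ≤ t j) (h1 : ∀ j, t j ≤ 1) (N G : ℕ)
    (σ : Fin s → ℝ) :
    ∑ n ∈ Finset.range N, ∏ j, condInterval (p j) (t j) G (n + realTrunc (p j) G (σ j)) -
        N * ∏ j, t j =
      ∑ g ∈ (Fintype.piFinset fun _ : Fin s => Finset.range (G + 1)).erase 0,
        haltonDiffSum p t N G g σ := by
  have h2 : haltonDiffSum p t N G 0 σ = N * ∏ j, t j := by
    simp [haltonDiffSum, intervalDiff_zero, h0, h1]
  rw [← h2, sub_eq_iff_eq_add, Finset.sum_erase_add _ _ (by simp)]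
  simp_rw [haltonDiffSum]
  rw [Finset.sum_comm]
  refine Finset.sum_congr rfl fun n _ => ?_
  simp_rw [← sum_intervalDiff]
  rw [Finset.prod_univ_sum]

variable [hp : ∀ j, Fact (p j).Prime]

theorem abs_haltonDiffSum_le (hinj : Function.Injective p) (N G : ℕ) {g : Fin s → ℕ} (hg : g ≠ 0)
    (σ : Fin s → ℝ) : |haltonDiffSum p t N G g σ| ≤ ∏ j, (p j : ℝ) :=
  abs_sum_prod_intervalDiff_le (fun j => (hp j).1) hinj t hg _ N

/-- The coordinates of the shift are independent, so a single coordinate with different levels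
annihilates every product indexed by a pair `n`, `n'`. -/
theorem integral_haltonDiffSum_mul (N : ℕ) {G : ℕ} {g g' : Fin s → ℕ} (hne : g ≠ g')
    (hg : ∀ j, g j ≤ G) (hg' : ∀ j, g' j ≤ G) :
    ∫ σ in unitCube s, haltonDiffSum p t N G g σ * haltonDiffSum p t N G g' σ = 0 := by
  obtain ⟨i, hi⟩ := Function.ne_iff.1 hne
  set f : ℕ → ℕ → Fin s → ℝ → ℝ := fun n n' j x =>
    intervalDiff (p j) (t j) (g j) (n + realTrunc (p j) G x) *
      intervalDiff (p j) (t j) (g' j) (n' + realTrunc (p j) G x) with hf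
  have h1 : ∀ σ : Fin s → ℝ, haltonDiffSum p t N G g σ * haltonDiffSum p t N G g' σ =
      ∑ n ∈ Finset.range N, ∑ n' ∈ Finset.range N, ∏ j, f n n' j (σ j) := by
    intro σ
    simp only [haltonDiffSum, Finset.sum_mul_sum, hf, Finset.prod_mul_distrib]
  have hint : ∀ n n', IntegrableOn (fun σ : Fin s → ℝ => ∏ j, f n n' j (σ j)) (unitCube s) := by
    intro n n'
    refine integrableOn_unitCube (C := 1) (Finset.measurable_fun_prod _ fun j _ =>
      (measurable_comp_realTrunc (fun z => intervalDiff (p j) (t j) (g j) (n + z) *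
        intervalDiff (p j) (t j) (g' j) (n' + z)) (p j) G).comp (measurable_pi_apply j)) fun σ => ?_
    rw [Finset.abs_prod]
    refine Finset.prod_le_one (fun _ _ => abs_nonneg _) fun j _ => ?_
    rw [hf, abs_mul]
    exact mul_le_one₀ (abs_intervalDiff_le_one _ _ _ _) (abs_nonneg _)
      (abs_intervalDiff_le_one _ _ _ _)
  simp_rw [h1]
  rw [integral_finsetSum _ fun n _ => integrable_finsetSum _ fun n' _ => hint n n']
  refine Finset.sum_eq_zero fun n _ => ?_
  rw [integral_finsetSum _ fun n' _ => hint n n']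
  refine Finset.sum_eq_zero fun n' _ => ?_
  rw [integral_pi_Ico_prod]
  refine Finset.prod_eq_zero (Finset.mem_univ i) ?_
  rw [integral_comp_realTrunc (hp i).1.pos G fun z => intervalDiff (p i) (t i) (g i) (n + z) *
    intervalDiff (p i) (t i) (g' i) (n' + z), sum_intervalDiff_mul_intervalDiff (hp i).1.pos _ hi
      (hg i) (hg' i), zero_div]

/-- By orthogonality only the diagonal survives: at most `(G + 1) ^ s` squares, each uniformly
bounded. -/
theorem integral_sq_sum_haltonDiffSum_le (hinj : Function.Injective p) (N G : ℕ) :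
    ∫ σ in unitCube s, (∑ g ∈ (Fintype.piFinset fun _ : Fin s => Finset.range (G + 1)).erase 0,
        haltonDiffSum p t N G g σ) ^ 2 ≤ ((G : ℝ) + 1) ^ s * (∏ j, (p j : ℝ)) ^ 2 := by
  set I := (Fintype.piFinset fun _ : Fin s => Finset.range (G + 1)).erase 0 with hI
  set B := ∏ j, (p j : ℝ) with hB
  have hI0 : ∀ g ∈ I, g ≠ 0 := fun g hg => Finset.ne_of_mem_erase hg
  have hIG : ∀ g ∈ I, ∀ j, g j ≤ G := fun g hg j =>
    Nat.lt_succ_iff.1 (Finset.mem_range.1 (Fintype.mem_piFinset.1 (Finset.mem_of_mem_erase hg) j))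
  have hbd : ∀ g ∈ I, ∀ g' ∈ I, ∀ σ,
      |haltonDiffSum p t N G g σ * haltonDiffSum p t N G g' σ| ≤ B ^ 2 := by
    intro g hg g' hg' σ
    rw [abs_mul, sq]
    exact mul_le_mul (abs_haltonDiffSum_le hinj N G (hI0 g hg) σ)
      (abs_haltonDiffSum_le hinj N G (hI0 g' hg') σ) (abs_nonneg _) (by positivity)
  have hint : ∀ g ∈ I, ∀ g' ∈ I, IntegrableOn
      (fun σ => haltonDiffSum p t N G g σ * haltonDiffSum p t N G g' σ) (unitCube s) :=
    fun g hg g' hg' => integrableOn_unitCube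
      ((measurable_haltonDiffSum p t N G g).mul (measurable_haltonDiffSum p t N G g'))
      (hbd g hg g' hg')
  simp_rw [sq (Finset.sum _ _), Finset.sum_mul_sum]
  rw [integral_finsetSum _ fun g hg => integrable_finsetSum _ fun g' hg' => hint g hg g' hg']
  calc _ = ∑ g ∈ I, ∫ σ in unitCube s, haltonDiffSum p t N G g σ * haltonDiffSum p t N G g σ := by
        refine Finset.sum_congr rfl fun g hg => ?_
        rw [integral_finsetSum _ fun g' hg' => hint g hg g' hg']
        refine Finset.sum_eq_single_of_mem g hg fun g' hg' hne => ?_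
        exact integral_haltonDiffSum_mul N hne.symm (hIG g hg) (hIG g' hg')
    _ ≤ ∑ g ∈ I, B ^ 2 := Finset.sum_le_sum fun g hg => setIntegral_unitCube_le (hbd g hg g hg)
    _ = (I.card : ℝ) * B ^ 2 := by rw [Finset.sum_const, nsmul_eq_mul]
    _ ≤ ((G : ℝ) + 1) ^ s * B ^ 2 := by
        gcongr
        have : I.card ≤ (G + 1) ^ s := by
          refine (Finset.card_le_card (Finset.erase_subset _ _)).trans ?_
          simp [Fintype.card_piFinset]
        exact_mod_cast this

end

/-! ### Truncation error, measurability and the mean square. -/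

/-- The indicator function of the two residue classes on which the first `G` digits do not
determine whether a point lies in `[0,t)`. -/
noncomputable def exceptionalIndicator (p : ℕ) (t : ℝ) (G z : ℕ) : ℝ :=
  (if digitRev p G z + 1 = p ^ G then 1 else 0) +
    if digitRev p G z + 1 = ⌈t * (p : ℝ) ^ G⌉₊ then 1 else 0

theorem exceptionalIndicator_nonneg (p : ℕ) (t : ℝ) (G z : ℕ) :
    0 ≤ exceptionalIndicator p t G z := by
  unfold exceptionalIndicator; split_ifs <;> norm_num

theorem exceptionalIndicator_le_two (p : ℕ) (t : ℝ) (G z : ℕ) :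
    exceptionalIndicator p t G z ≤ 2 := by
  unfold exceptionalIndicator; split_ifs <;> norm_num

/-- Each of the two conditions fixes all `G` digits, hence one residue. -/
theorem sum_exceptionalIndicator_le {p : ℕ} (hp : 0 < p) (t : ℝ) (G n : ℕ) :
    ∑ r ∈ Finset.range (p ^ G), exceptionalIndicator p t G (n + r) ≤ 2 := by
  have key : ∀ c : ℕ, ∑ r ∈ Finset.range (p ^ G),
      (if digitRev p G (n + r) + 1 = c then (1 : ℝ) else 0) ≤ 1 := by
    intro c
    rw [Finset.sum_boole]
    have : ((Finset.range (p ^ G)).filter fun r => digitRev p G (n + r) + 1 = c).card ≤ 1 := by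
      rw [Finset.card_le_one]
      intro a ha b hb
      rw [Finset.mem_filter, Finset.mem_range] at ha hb
      have h1 : digitRev p G (n + a) = digitRev p G (n + b) := by omega
      have h2 := Nat.ModEq.add_left_cancel' n (modEq_of_digitRev_eq hp h1)
      rwa [Nat.ModEq, Nat.mod_eq_of_lt ha.1, Nat.mod_eq_of_lt hb.1] at h2
    exact_mod_cast this
  unfold exceptionalIndicator
  rw [Finset.sum_add_distrib]
  linarith [key (p ^ G), key ⌈t * (p : ℝ) ^ G⌉₊]

theorem abs_indicator_sub_condInterval_le {p : ℕ} [hp : Fact p.Prime] (t : ℝ) (G n : ℕ) (x : ℝ) :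
    |(Set.Ico 0 t).indicator (fun _ => (1 : ℝ))
        (monna p (monnaInv p (radicalInverse p n) + monnaInv p x)) -
      condInterval p t G (n + realTrunc p G x)| ≤
      exceptionalIndicator p t G (n + realTrunc p G x) := by
  set z := monnaInv p (radicalInverse p n) + monnaInv p x with hz
  have hmod : z.appr G ≡ n + realTrunc p G x [MOD p ^ G] := by
    rw [hz, appr_monnaInv_radicalInverse_add]
    exact Nat.mod_modEq _ _
  rw [← condInterval_congr hmod, exceptionalIndicator, ← digitRev_congr hmod]
  by_cases h : digitRev p G (z.appr G) + 1 ≠ p ^ G ∧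
      digitRev p G (z.appr G) + 1 ≠ ⌈t * (p : ℝ) ^ G⌉₊
  · rw [indicator_monna_eq z h.1 h.2]
    simp [h.1, h.2]
  · have h1 : |(Set.Ico 0 t).indicator (fun _ => (1 : ℝ)) (monna p z) -
        condInterval p t G (z.appr G)| ≤ 1 := by
      have h2 := clampUnit_nonneg (t * (p : ℝ) ^ G - digitRev p G (z.appr G))
      have h3 := clampUnit_le_one (t * (p : ℝ) ^ G - digitRev p G (z.appr G))
      have h4 : 0 ≤ (Set.Ico 0 t).indicator (fun _ => (1 : ℝ)) (monna p z) :=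
        Set.indicator_nonneg (fun _ _ => zero_le_one) _
      have h5 := (abs_le.1 (abs_indicator_one_le (Set.Ico 0 t) (monna p z))).2
      rw [condInterval, abs_le]
      constructor <;> linarith
    refine h1.trans ?_
    split_ifs with h2 h3 h3
    · norm_num
    · norm_num
    · norm_num
    · exact absurd ⟨h2, h3⟩ h

/-- Before reduction modulo `1`, the map is a pointwise limit of functions of finitely many digits
of `x`. -/
theorem measurable_monna_add {p : ℕ} [hp : Fact p.Prime] (n : ℕ) :
    Measurable fun x => monna p (monnaInv p (radicalInverse p n) + monnaInv p x) := by
  unfold monna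
  refine measurable_fract.comp ?_
  refine measurable_of_tendsto_metrizable (f := fun G x =>
    (digitRev p G ((n + realTrunc p G x) % p ^ G) : ℝ) / (p : ℝ) ^ G) (fun G => ?_) ?_
  · exact measurable_comp_realTrunc
      (fun z => (digitRev p G ((n + z) % p ^ G) : ℝ) / (p : ℝ) ^ G) p G
  · rw [tendsto_pi_nhds]
    intro x
    have hb := fun G => tsum_padicDigit_mem (monnaInv p (radicalInverse p n) + monnaInv p x) G
    simp only [appr_monnaInv_radicalInverse_add, add_div] at hb
    have hlim : Filter.Tendsto (fun G : ℕ => 1 / (p : ℝ) ^ G) Filter.atTop (nhds 0) := by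
      simpa using tendsto_pow_atTop_nhds_zero_of_lt_one (r := (p : ℝ)⁻¹) (by positivity)
        (inv_lt_one_of_one_lt₀ (by exact_mod_cast hp.1.one_lt))
    rw [tendsto_iff_norm_sub_tendsto_zero]
    refine squeeze_zero_norm (fun G => ?_) hlim
    rw [norm_norm, Real.norm_eq_abs, abs_le]
    have h1 : 0 ≤ 1 / (p : ℝ) ^ G := by positivity
    constructor <;> linarith [(hb G).1, (hb G).2]

theorem measurable_shiftedHalton {s : ℕ} (p : Fin s → ℕ) [∀ j, Fact (p j).Prime] (n : ℕ) (j : Fin s) :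
    Measurable fun σ => shiftedHalton p σ n j :=
  (measurable_monna_add n).comp (measurable_pi_apply j)

/-- The mean square of the local discrepancy of the shifted Halton sequence. -/
theorem integral_sq_localDiscrepancy_le {s : ℕ} {p : Fin s → ℕ} [hp : ∀ j, Fact (p j).Prime]
    (hinj : Function.Injective p) {t : Fin s → ℝ} (h0 : ∀ j, 0 ≤ t j) (h1 : ∀ j, t j ≤ 1)
    {N G : ℕ} (hG : N ^ 2 ≤ 2 ^ G) :
    ∫ σ in unitCube s, (N * localDiscrepancy (shiftedHalton p σ) N t) ^ 2 ≤
      2 * (((G : ℝ) + 1) ^ s * (∏ j, (p j : ℝ)) ^ 2) + 8 * s ^ 2 := by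
  set I := (Fintype.piFinset fun _ : Fin s => Finset.range (G + 1)).erase 0 with hI
  set S : (Fin s → ℝ) → ℝ := fun σ => ∑ g ∈ I, haltonDiffSum p t N G g σ with hS
  set V : (Fin s → ℝ) → ℝ := fun σ => ∑ n ∈ Finset.range N, ∑ j,
    exceptionalIndicator (p j) (t j) G (n + realTrunc (p j) G (σ j)) with hV
  have hSm : Measurable S := Finset.measurable_fun_sum _ fun g _ => measurable_haltonDiffSum p t N G g
  have hterm : ∀ n j, Measurable fun σ : Fin s → ℝ =>
      exceptionalIndicator (p j) (t j) G (n + realTrunc (p j) G (σ j)) := fun n j =>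
    (measurable_comp_realTrunc (fun z => exceptionalIndicator (p j) (t j) G (n + z)) (p j) G).comp
      (measurable_pi_apply j)
  have hVm : Measurable V :=
    Finset.measurable_fun_sum _ fun n _ => Finset.measurable_fun_sum _ fun j _ => hterm n j
  have hV0 : ∀ σ, 0 ≤ V σ := fun σ =>
    Finset.sum_nonneg fun n _ => Finset.sum_nonneg fun j _ => exceptionalIndicator_nonneg _ _ _ _
  have hVle : ∀ σ, V σ ≤ 2 * s * N := fun σ => by
    calc V σ ≤ ∑ n ∈ Finset.range N, ∑ j : Fin s, (2 : ℝ) :=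
          Finset.sum_le_sum fun n _ => Finset.sum_le_sum fun j _ => exceptionalIndicator_le_two _ _ _ _
      _ = 2 * s * N := by simp; ring
  have hSb : ∀ σ, |S σ| ≤ ∑ g ∈ I, ∏ j, (p j : ℝ) := fun σ =>
    (Finset.abs_sum_le_sum_abs _ _).trans <| Finset.sum_le_sum fun g hg =>
      abs_haltonDiffSum_le hinj N G (Finset.ne_of_mem_erase hg) σ
  have hclose : ∀ σ, |N * localDiscrepancy (shiftedHalton p σ) N t - S σ| ≤ V σ := by
    intro σ
    rw [natCast_mul_localDiscrepancy, hS]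
    simp only
    rw [← sum_prod_condInterval_sub h0 h1, sub_sub_sub_cancel_right, ← Finset.sum_sub_distrib]
    refine (Finset.abs_sum_le_sum_abs _ _).trans (Finset.sum_le_sum fun n _ => ?_)
    refine (abs_prod_sub_prod_le_sum _ (fun j => abs_indicator_one_le _ _) fun j => ?_).trans
      (Finset.sum_le_sum fun j _ => abs_indicator_sub_condInterval_le _ _ _ _)
    rw [condInterval, abs_of_nonneg (clampUnit_nonneg _)]
    exact clampUnit_le_one _
  -- `W ^ 2 ≤ 2 * S ^ 2 + 2 * (W - S) ^ 2`, and one factor of `V ^ 2` is replaced by the supremum of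
  -- `V`, so that only the mean of `V` is needed.
  have hpt : ∀ σ, (N * localDiscrepancy (shiftedHalton p σ) N t) ^ 2 ≤
      2 * S σ ^ 2 + 2 * (2 * s * N) * V σ := by
    intro σ
    have h2 := hclose σ
    set W := N * localDiscrepancy (shiftedHalton p σ) N t
    have h3 : (W - S σ) ^ 2 ≤ V σ ^ 2 := sq_le_sq' (by linarith [(abs_le.1 h2).1]) (abs_le.1 h2).2
    have h4 : V σ ^ 2 ≤ 2 * s * N * V σ := by
      rw [sq]; exact mul_le_mul_of_nonneg_right (hVle σ) (hV0 σ)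
    nlinarith [sq_nonneg (W - 2 * S σ)]
  have hSi : IntegrableOn (fun σ => S σ ^ 2) (unitCube s) :=
    integrableOn_unitCube (hSm.pow_const 2) (C := (∑ g ∈ I, ∏ j, (p j : ℝ)) ^ 2) fun σ => by
      rw [abs_pow]; exact pow_le_pow_left₀ (abs_nonneg _) (hSb σ) 2
  have hVi : IntegrableOn V (unitCube s) :=
    integrableOn_unitCube hVm (C := 2 * s * N) fun σ => by
      rw [abs_of_nonneg (hV0 σ)]; exact hVle σ
  have hVint : ∫ σ in unitCube s, V σ ≤ N * (s * (2 / 2 ^ G)) := by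
    have hti : ∀ n j, IntegrableOn (fun σ : Fin s → ℝ =>
        exceptionalIndicator (p j) (t j) G (n + realTrunc (p j) G (σ j))) (unitCube s) :=
      fun n j => integrableOn_unitCube (hterm n j) (C := 2) fun σ => by
        rw [abs_of_nonneg (exceptionalIndicator_nonneg _ _ _ _)]
        exact exceptionalIndicator_le_two _ _ _ _
    have hone : ∀ n j, ∫ σ in unitCube s,
        exceptionalIndicator (p j) (t j) G (n + realTrunc (p j) G (σ j)) ≤ 2 / 2 ^ G := by
      intro n j
      -- Factors `1` in the other coordinates make the product formula for integrals applicable.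
      set φ : Fin s → ℝ → ℝ := fun i x => if i = j then
        exceptionalIndicator (p j) (t j) G (n + realTrunc (p j) G x) else 1 with hφ
      have h2 : ∀ σ : Fin s → ℝ, exceptionalIndicator (p j) (t j) G (n + realTrunc (p j) G (σ j)) =
          ∏ i, φ i (σ i) := fun σ => by
        simp [hφ, Finset.prod_ite_eq']
      rw [(setIntegral_congr_fun (measurableSet_unitCube s) fun σ _ => h2 σ).trans
        (integral_pi_Ico_prod φ), Finset.prod_eq_single j]
      · simp only [hφ, if_true]
        rw [integral_comp_realTrunc (hp j).1.pos G
          fun z => exceptionalIndicator (p j) (t j) G (n + z)]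
        have h3 : (2 : ℝ) ≤ p j := by exact_mod_cast (hp j).1.two_le
        gcongr
        exact sum_exceptionalIndicator_le (hp j).1.pos _ _ _
      · intro i _ hi
        simp [hφ, hi]
      · simp
    rw [hV, integral_finsetSum _ fun n _ => integrable_finsetSum _ fun j _ => hti n j]
    calc _ ≤ ∑ n ∈ Finset.range N, ∑ j : Fin s, (2 / 2 ^ G : ℝ) := by
          refine Finset.sum_le_sum fun n _ => ?_
          rw [integral_finsetSum _ fun j _ => hti n j]
          exact Finset.sum_le_sum fun j _ => hone n j
      _ = N * (s * (2 / 2 ^ G)) := by simp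
  -- The truncation contributes `8 * s ^ 2 * N ^ 2 / 2 ^ G`; this is where `N ^ 2 ≤ 2 ^ G` enters.
  have hN2 : (N : ℝ) ^ 2 / 2 ^ G ≤ 1 := by
    rw [div_le_one (by positivity)]
    exact_mod_cast hG
  calc ∫ σ in unitCube s, (N * localDiscrepancy (shiftedHalton p σ) N t) ^ 2
      ≤ ∫ σ in unitCube s, (2 * S σ ^ 2 + 2 * (2 * s * N) * V σ) :=
        integral_mono_of_nonneg (Filter.Eventually.of_forall fun σ => sq_nonneg _)
          ((hSi.const_mul 2).add (hVi.const_mul _)) (Filter.Eventually.of_forall hpt)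
    _ = 2 * (∫ σ in unitCube s, S σ ^ 2) + 2 * (2 * s * N) * ∫ σ in unitCube s, V σ := by
        rw [integral_add (hSi.const_mul 2) (hVi.const_mul _), integral_const_mul,
          integral_const_mul]
    _ ≤ 2 * (((G : ℝ) + 1) ^ s * (∏ j, (p j : ℝ)) ^ 2) +
        2 * (2 * s * N) * (N * (s * (2 / 2 ^ G))) := by
        gcongr
        exact integral_sq_sum_haltonDiffSum_le hinj N G
    _ = 2 * (((G : ℝ) + 1) ^ s * (∏ j, (p j : ℝ)) ^ 2) + 8 * s ^ 2 * ((N : ℝ) ^ 2 / 2 ^ G) := by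
        ring
    _ ≤ _ := by
        have := mul_le_of_le_one_right (show (0 : ℝ) ≤ 8 * s ^ 2 by positivity) hN2
        linarith

/-! ### Haar functions -/

/-- The `k`-th Haar function of a sequence of consecutive cells: `1` on the cell `2 * k`, `-1` on
the cell `2 * k + 1`, and `0` elsewhere. -/
noncomputable def haarSign (k m : ℕ) : ℝ :=
  if m = 2 * k then 1 else if m = 2 * k + 1 then -1 else 0

theorem haarSign_two_mul (k : ℕ) : haarSign k (2 * k) = 1 := by simp [haarSign]

theorem haarSign_two_mul_add_one (k : ℕ) : haarSign k (2 * k + 1) = -1 := by simp [haarSign]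

theorem haarSign_mul_of_ne {k k' : ℕ} (h : k ≠ k') (m : ℕ) : haarSign k m * haarSign k' m = 0 := by
  unfold haarSign
  split_ifs <;> first | omega | simp

theorem abs_haarSign_le (k m : ℕ) : |haarSign k m| ≤ 1 := by
  unfold haarSign
  split_ifs <;> simp

/-- The Haar function of level `r` on the unit interval that is supported on
`[k / 2 ^ r, (k + 1) / 2 ^ r)`. -/
noncomputable def haar (r k : ℕ) (t : ℝ) : ℝ := haarSign k ⌊t * 2 ^ (r + 1)⌋₊

theorem measurable_haar (r k : ℕ) : Measurable (haar r k) :=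
  (measurable_from_top (f := haarSign k)).comp
    (Nat.measurable_floor.comp (measurable_id.mul_const _))

theorem abs_haar_le (r k : ℕ) (t : ℝ) : |haar r k t| ≤ 1 := abs_haarSign_le _ _

/-- The dyadic interval `[j / 2 ^ r, (j + 1) / 2 ^ r)`. -/
def dyadicIco (r j : ℕ) : Set ℝ := Set.Ico ((j : ℝ) / 2 ^ r) ((j + 1 : ℝ) / 2 ^ r)

theorem mem_dyadicIco_iff {r j : ℕ} {t : ℝ} (ht : 0 ≤ t) :
    t ∈ dyadicIco r j ↔ ⌊t * 2 ^ r⌋₊ = j := by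
  rw [dyadicIco, Set.mem_Ico, div_le_iff₀ (by positivity), lt_div_iff₀ (by positivity),
    Nat.floor_eq_iff (by positivity)]

theorem nonneg_of_mem_dyadicIco {r j : ℕ} {t : ℝ} (h : t ∈ dyadicIco r j) : 0 ≤ t :=
  le_trans (by positivity) h.1

theorem measurableSet_dyadicIco (r j : ℕ) : MeasurableSet (dyadicIco r j) := measurableSet_Ico

theorem volume_real_dyadicIco (r j : ℕ) : volume.real (dyadicIco r j) = 1 / 2 ^ r := by
  rw [dyadicIco, Real.volume_real_Ico_of_le (by gcongr; linarith)]
  ring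

theorem dyadicIco_subset {r j : ℕ} (h : j < 2 ^ r) : dyadicIco r j ⊆ Set.Icc 0 1 := by
  intro t ht
  refine ⟨nonneg_of_mem_dyadicIco ht, ht.2.le.trans ?_⟩
  rw [div_le_one (by positivity)]
  exact_mod_cast h

theorem floor_mul_two_pow {R r : ℕ} (h : R ≤ r) (t : ℝ) :
    ⌊t * 2 ^ R⌋₊ = ⌊t * 2 ^ r⌋₊ / 2 ^ (r - R) := by
  have h1 : (2 : ℝ) ^ r = 2 ^ R * 2 ^ (r - R) := by rw [← pow_add, Nat.add_sub_cancel' h]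
  rw [← Nat.floor_div_natCast, h1]
  push_cast
  rw [← mul_assoc, mul_div_cancel_right₀ _ (by positivity)]

theorem floor_eq_of_mem_dyadicIco {r k j : ℕ} {t : ℝ} (ht : t ∈ dyadicIco (r + 1) j)
    (hj : j / 2 = k) : ⌊t * 2 ^ r⌋₊ = k := by
  rw [floor_mul_two_pow r.le_succ, (mem_dyadicIco_iff (nonneg_of_mem_dyadicIco ht)).1 ht]
  simpa using hj

theorem integral_haar_mul {r k : ℕ} (hk : k < 2 ^ r) {g : ℝ → ℝ}
    (hg : IntegrableOn g (Set.Icc 0 1)) :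
    ∫ t in Set.Icc (0 : ℝ) 1, haar r k t * g t =
      (∫ t in dyadicIco (r + 1) (2 * k), g t) - ∫ t in dyadicIco (r + 1) (2 * k + 1), g t := by
  have h1 : ∀ t ∈ Set.Icc (0 : ℝ) 1, haar r k t * g t =
      (dyadicIco (r + 1) (2 * k)).indicator g t - (dyadicIco (r + 1) (2 * k + 1)).indicator g t := by
    intro t ht
    classical
    simp only [Set.indicator_apply, mem_dyadicIco_iff ht.1, haar, haarSign]
    split_ifs with h2 h3 <;> first | omega | simp
  have h2 : ∀ j, IntegrableOn ((dyadicIco (r + 1) j).indicator g) (Set.Icc 0 1) := fun j =>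
    hg.indicator (measurableSet_dyadicIco _ _)
  rw [setIntegral_congr_fun measurableSet_Icc h1, integral_sub (h2 _) (h2 _),
    setIntegral_indicator (measurableSet_dyadicIco _ _),
    setIntegral_indicator (measurableSet_dyadicIco _ _),
    Set.inter_eq_right.2 (dyadicIco_subset (by rw [pow_succ]; omega)),
    Set.inter_eq_right.2 (dyadicIco_subset (by rw [pow_succ]; omega))]

theorem setIntegral_dyadicIco_const {r j : ℕ} {g : ℝ → ℝ} {c : ℝ}
    (h : ∀ t ∈ dyadicIco r j, g t = c) : ∫ t in dyadicIco r j, g t = c / 2 ^ r := by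
  rw [setIntegral_congr_fun (measurableSet_dyadicIco r j) h, setIntegral_const,
    volume_real_dyadicIco, smul_eq_mul]
  ring

theorem integrableOn_Icc_of_bounded {g : ℝ → ℝ} (hg : Measurable g) {C : ℝ} (hC : ∀ t, |g t| ≤ C) :
    IntegrableOn g (Set.Icc 0 1) :=
  Measure.integrableOn_of_bounded (by simp) hg.aestronglyMeasurable
    (Filter.Eventually.of_forall hC)

/-- A Haar function has mean zero, so it annihilates whatever is constant on its support. Both
orthogonality and the vanishing for points outside the support follow from this. -/
theorem integral_haar_mul_eq_zero {r k : ℕ} (hk : k < 2 ^ r) {g : ℝ → ℝ}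
    (hg : Measurable g) (hg1 : ∀ t, |g t| ≤ 1) {c : ℝ}
    (h : ∀ t, 0 ≤ t → ⌊t * 2 ^ r⌋₊ = k → g t = c) :
    ∫ t in Set.Icc (0 : ℝ) 1, haar r k t * g t = 0 := by
  rw [integral_haar_mul hk (integrableOn_Icc_of_bounded hg hg1),
    setIntegral_dyadicIco_const (c := c) fun t ht => h t (nonneg_of_mem_dyadicIco ht)
      (floor_eq_of_mem_dyadicIco ht (by omega)),
    setIntegral_dyadicIco_const (c := c) fun t ht => h t (nonneg_of_mem_dyadicIco ht)
      (floor_eq_of_mem_dyadicIco ht (by omega)), sub_self]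

theorem integral_haar_mul_id {r k : ℕ} (hk : k < 2 ^ r) :
    ∫ t in Set.Icc (0 : ℝ) 1, haar r k t * t = -(1 / 4 ^ (r + 1)) := by
  have h1 : ∀ j : ℕ, ∫ t in dyadicIco (r + 1) j, t =
      (((j + 1 : ℝ) / 2 ^ (r + 1)) ^ 2 - ((j : ℝ) / 2 ^ (r + 1)) ^ 2) / 2 := fun j => by
    rw [dyadicIco, integral_Ico_eq_integral_Ioc, ← intervalIntegral.integral_of_le
      (by gcongr; linarith), integral_id]
  rw [integral_haar_mul hk (g := fun t => t) (continuous_id.integrableOn_Icc), h1, h1]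
  have h4 : (4 : ℝ) ^ (r + 1) = 2 ^ (r + 1) * 2 ^ (r + 1) := by rw [← mul_pow]; norm_num
  rw [h4]
  push_cast
  field_simp
  ring

theorem integral_haar_mul_self {r k : ℕ} (hk : k < 2 ^ r) :
    ∫ t in Set.Icc (0 : ℝ) 1, haar r k t * haar r k t = 1 / 2 ^ r := by
  have h1 : ∀ j, ∀ t ∈ dyadicIco (r + 1) j, haar r k t = haarSign k j := fun j t ht => by
    rw [haar, (mem_dyadicIco_iff (nonneg_of_mem_dyadicIco ht)).1 ht]
  rw [integral_haar_mul hk (integrableOn_Icc_of_bounded (measurable_haar r k) (abs_haar_le r k)),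
    setIntegral_dyadicIco_const (h1 _), setIntegral_dyadicIco_const (h1 _), haarSign_two_mul,
    haarSign_two_mul_add_one, pow_succ]
  field_simp
  norm_num

theorem integral_haar_mul_haar_of_ne {r k r' k' : ℕ} (hk : k < 2 ^ r) (hk' : k' < 2 ^ r')
    (hne : r ≠ r' ∨ k ≠ k') :
    ∫ t in Set.Icc (0 : ℝ) 1, haar r k t * haar r' k' t = 0 := by
  by_cases hr : r = r'
  · subst hr
    have hkk : k ≠ k' := hne.resolve_left fun h => h rfl
    simp [haar, haarSign_mul_of_ne hkk]
  wlog hlt : r < r' generalizing r k r' k'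
  · simpa only [mul_comm] using this hk' hk (Or.inl (Ne.symm hr)) (Ne.symm hr) (by omega)
  simp_rw [mul_comm (haar r k _)]
  -- The coarser Haar function is constant on the support of the finer one.
  refine integral_haar_mul_eq_zero hk' (measurable_haar r k) (abs_haar_le r k)
    (c := haarSign k (k' / 2 ^ (r' - (r + 1)))) fun t _ ht => ?_
  rw [haar, floor_mul_two_pow (show r + 1 ≤ r' by omega), ht]

theorem measurable_indicator_Ico (x : ℝ) :
    Measurable fun t => (Set.Ico 0 t).indicator (fun _ => (1 : ℝ)) x := by
  simp only [Set.indicator_apply, Set.mem_Ico]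
  refine Measurable.ite ?_ measurable_const measurable_const
  exact (MeasurableSet.const _).inter (measurableSet_lt measurable_const measurable_id)

/-- As a function of `t` the indicator can jump only at `x`, and it vanishes identically for `x <
0`; hence it is constant on a dyadic interval without `x`. -/
theorem integral_haar_mul_indicator {r k : ℕ} (hk : k < 2 ^ r) {x : ℝ} (hx : ⌊x * 2 ^ r⌋₊ ≠ k) :
    ∫ t in Set.Icc (0 : ℝ) 1, haar r k t * (Set.Ico 0 t).indicator (fun _ => (1 : ℝ)) x = 0 := by
  refine integral_haar_mul_eq_zero hk (measurable_indicator_Ico x)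
    (fun t => abs_indicator_one_le _ _) (c := if 0 ≤ x ∧ ⌊x * 2 ^ r⌋₊ < k then 1 else 0)
    fun t ht0 ht => ?_
  rw [Set.indicator_apply]
  refine if_congr (and_congr_right fun hx0 => ?_) rfl rfl
  have h2 : (0 : ℝ) < 2 ^ r := by positivity
  rw [Nat.floor_eq_iff (by positivity)] at ht
  rcases lt_or_gt_of_ne hx with h | h
  · refine iff_of_true (lt_of_mul_lt_mul_right ?_ h2.le) h
    exact ((Nat.floor_lt (by positivity)).1 h).trans_le ht.1
  · refine iff_of_false (not_lt.2 (le_of_mul_le_mul_right ?_ h2)) (by omega)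
    have h3 := (Nat.le_floor_iff (by positivity)).1 (Nat.succ_le_of_lt h)
    push_cast at h3
    linarith [ht.2]

/-! ### Haar functions of the discrete time variable, and Bessel's inequality. -/

theorem sum_range_mul_eq (f : ℕ → ℝ) (b M : ℕ) :
    ∑ τ ∈ Finset.range (b * M), f τ = ∑ m ∈ Finset.range M, ∑ j ∈ Finset.range b, f (b * m + j) := by
  induction M with
  | zero => simp
  | succ M ih => rw [Nat.mul_succ, Finset.sum_range_add, ih, Finset.sum_range_succ]

/-- The discrete counterpart of `integral_haar_mul`, where a half of the support consists of `b`
consecutive times. -/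
theorem sum_haarSign_mul {b K k : ℕ} (hb : 0 < b) (hk : k < K) (g : ℕ → ℝ) :
    ∑ τ ∈ Finset.range (2 * b * K), haarSign k (τ / b) * g τ =
      ∑ j ∈ Finset.range b, (g (b * (2 * k) + j) - g (b * (2 * k + 1) + j)) := by
  have h1 : ∀ m, ∀ j ∈ Finset.range b,
      haarSign k ((b * m + j) / b) * g (b * m + j) = haarSign k m * g (b * m + j) := by
    intro m j hj
    rw [Nat.mul_add_div hb, Nat.div_eq_of_lt (Finset.mem_range.1 hj), add_zero]
  rw [show 2 * b * K = b * (2 * K) by ring, sum_range_mul_eq]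
  simp_rw [Finset.sum_congr rfl (h1 _), ← Finset.mul_sum]
  rw [Finset.sum_eq_add_of_mem (2 * k) (2 * k + 1) (Finset.mem_range.2 (by omega))
    (Finset.mem_range.2 (by omega)) (by omega), haarSign_two_mul, haarSign_two_mul_add_one,
    Finset.sum_sub_distrib]
  · ring
  · rintro m - ⟨h2, h3⟩
    simp [haarSign, h2, h3]

/-- The condition `n < τ` changes only between the times `n` and `n + 1`, which does not happen
inside a block of length `2 * b` not containing `n`. -/
theorem sum_haarSign_mul_eq_zero {b K k n : ℕ} (hb : 0 < b) (hk : k < K) (hn : n / (2 * b) ≠ k) :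
    ∑ τ ∈ Finset.range (2 * b * K), haarSign k (τ / b) * (if n < τ then 1 else 0) = 0 := by
  rw [sum_haarSign_mul hb hk]
  refine Finset.sum_eq_zero fun j hj => ?_
  rw [Finset.mem_range] at hj
  have h2b : 0 < 2 * b := by omega
  have h1 : n < b * (2 * k) + j ↔ n < b * (2 * k + 1) + j := by
    rcases lt_or_gt_of_ne hn with h | h
    · have h2 : n < k * (2 * b) := (Nat.div_lt_iff_lt_mul h2b).1 h
      have h3 : b * (2 * k) = k * (2 * b) := by ring
      have h4 : b * (2 * k + 1) = k * (2 * b) + b := by ring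
      omega
    · have h2 : (k + 1) * (2 * b) ≤ n := (Nat.le_div_iff_mul_le h2b).1 h
      have h3 : b * (2 * k) + 2 * b = (k + 1) * (2 * b) := by ring
      have h4 : b * (2 * k + 1) = b * (2 * k) + b := by ring
      omega
  simp only [h1, sub_self]

theorem sum_haarSign_mul_id {b K k : ℕ} (hb : 0 < b) (hk : k < K) :
    ∑ τ ∈ Finset.range (2 * b * K), haarSign k (τ / b) * (τ : ℝ) = -(b : ℝ) ^ 2 := by
  rw [sum_haarSign_mul hb hk fun τ => (τ : ℝ)]
  have : ∀ j : ℕ, ((b * (2 * k) + j : ℕ) : ℝ) - ((b * (2 * k + 1) + j : ℕ) : ℝ) = -b := fun j => by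
    push_cast; ring
  simp_rw [this]
  simp
  ring

theorem sum_haarSign_mul_self {b K k : ℕ} (hb : 0 < b) (hk : k < K) :
    ∑ τ ∈ Finset.range (2 * b * K), haarSign k (τ / b) * haarSign k (τ / b) = 2 * b := by
  rw [sum_haarSign_mul hb hk fun τ => haarSign k (τ / b)]
  have : ∀ j ∈ Finset.range b, haarSign k ((b * (2 * k) + j) / b) -
      haarSign k ((b * (2 * k + 1) + j) / b) = 2 := by
    intro j hj
    rw [Nat.mul_add_div hb, Nat.mul_add_div hb, Nat.div_eq_of_lt (Finset.mem_range.1 hj), add_zero,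
      add_zero, haarSign_two_mul, haarSign_two_mul_add_one]
    norm_num
  rw [Finset.sum_congr rfl this]
  simp
  ring

/-- A form of Bessel's inequality. -/
theorem two_mul_card_mul_sq_le {X κ : Type*} [MeasurableSpace X] [DecidableEq κ] {μ : Measure X}
    (E : Finset κ) (T : ℕ) (D : ℕ → X → ℝ) (h : κ → ℕ → X → ℝ) {ε : ℝ}
    (hDD : ∀ τ, Integrable (fun x => D τ x ^ 2) μ)
    (hhD : ∀ R ∈ E, ∀ τ, Integrable (fun x => h R τ x * D τ x) μ)
    (hhh : ∀ R ∈ E, ∀ R' ∈ E, ∀ τ, Integrable (fun x => h R τ x * h R' τ x) μ)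
    (hε : ∀ R ∈ E, ∑ τ ∈ Finset.range T, ∫ x, h R τ x * D τ x ∂μ = ε)
    (horth : ∀ R ∈ E, ∀ R' ∈ E, ∑ τ ∈ Finset.range T, ∫ x, h R τ x * h R' τ x ∂μ =
      if R = R' then 1 / 2 else 0) :
    2 * E.card * ε ^ 2 ≤ ∑ τ ∈ Finset.range T, ∫ x, D τ x ^ 2 ∂μ := by
  -- The coefficient `2 * ε` is that of the orthogonal projection: inner product `ε` divided by
  -- squared norm `1 / 2`.
  have h1 : ∀ τ, ∫ x, (D τ x - 2 * ε * ∑ R ∈ E, h R τ x) ^ 2 ∂μ =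
      ∫ x, D τ x ^ 2 ∂μ - 4 * ε * ∑ R ∈ E, ∫ x, h R τ x * D τ x ∂μ +
        4 * ε ^ 2 * ∑ R ∈ E, ∑ R' ∈ E, ∫ x, h R τ x * h R' τ x ∂μ := by
    intro τ
    have h2 : ∀ x, (D τ x - 2 * ε * ∑ R ∈ E, h R τ x) ^ 2 =
        D τ x ^ 2 - 4 * ε * ∑ R ∈ E, h R τ x * D τ x +
          4 * ε ^ 2 * ∑ R ∈ E, ∑ R' ∈ E, h R τ x * h R' τ x := by
      intro x
      rw [← Finset.sum_mul_sum, ← Finset.sum_mul]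
      ring
    have i1 : Integrable (fun x => ∑ R ∈ E, h R τ x * D τ x) μ :=
      integrable_finsetSum _ fun R hR => hhD R hR τ
    have i2 : ∀ R ∈ E, Integrable (fun x => ∑ R' ∈ E, h R τ x * h R' τ x) μ := fun R hR =>
      integrable_finsetSum _ fun R' hR' => hhh R hR R' hR' τ
    have i3 : Integrable (fun x => D τ x ^ 2 - 4 * ε * ∑ R ∈ E, h R τ x * D τ x) μ :=
      (hDD τ).sub (i1.const_mul _)
    simp_rw [h2]
    rw [integral_add i3 ((integrable_finsetSum _ i2).const_mul _),
      integral_sub (hDD τ) (i1.const_mul _),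
      integral_const_mul, integral_const_mul, integral_finsetSum _ fun R hR => hhD R hR τ,
      integral_finsetSum _ i2]
    congr 2
    exact Finset.sum_congr rfl fun R hR => integral_finsetSum _ fun R' hR' => hhh R hR R' hR' τ
  have h3 : 0 ≤ ∑ τ ∈ Finset.range T, ∫ x, (D τ x - 2 * ε * ∑ R ∈ E, h R τ x) ^ 2 ∂μ :=
    Finset.sum_nonneg fun τ _ => integral_nonneg fun x => sq_nonneg _
  have h4 : ∑ τ ∈ Finset.range T, ∑ R ∈ E, ∫ x, h R τ x * D τ x ∂μ = E.card * ε := by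
    rw [Finset.sum_comm, Finset.sum_congr rfl hε, Finset.sum_const, nsmul_eq_mul]
  have h5 : ∑ τ ∈ Finset.range T, ∑ R ∈ E, ∑ R' ∈ E, ∫ x, h R τ x * h R' τ x ∂μ =
      E.card * (1 / 2) := by
    rw [Finset.sum_comm]
    calc _ = ∑ R ∈ E, (1 / 2 : ℝ) := by
          refine Finset.sum_congr rfl fun R hR => ?_
          rw [Finset.sum_comm, Finset.sum_congr rfl (horth R hR), Finset.sum_ite_eq, if_pos hR]
      _ = _ := by rw [Finset.sum_const, nsmul_eq_mul]
  simp_rw [h1] at h3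
  rw [Finset.sum_add_distrib, Finset.sum_sub_distrib, ← Finset.mul_sum, ← Finset.mul_sum, h4,
    h5] at h3
  linarith

/-! ### Roth's lower bound -/

theorem abs_apply_le_one_of_mem_Icc {ι : Type*} {t : ι → ℝ} (ht : t ∈ Set.Icc (0 : ι → ℝ) 1) (i : ι) :
    |t i| ≤ 1 := by
  rw [abs_of_nonneg (ht.1 i)]; exact ht.2 i

section
variable {ι : Type*} [Fintype ι]

theorem integrableOn_Icc_pi {f : (ι → ℝ) → ℝ} (hf : Measurable f) {C : ℝ}
    (hC : ∀ t ∈ Set.Icc (0 : ι → ℝ) 1, |f t| ≤ C) : IntegrableOn f (Set.Icc (0 : ι → ℝ) 1) :=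
  Measure.integrableOn_of_bounded isCompact_Icc.measure_lt_top.ne hf.aestronglyMeasurable
    (ae_restrict_of_forall_mem measurableSet_Icc hC)

theorem integral_Icc_pi_prod (f : ι → ℝ → ℝ) :
    ∫ t in Set.Icc (0 : ι → ℝ) 1, ∏ i, f i (t i) = ∏ i, ∫ x in Set.Icc (0 : ℝ) 1, f i x := by
  rw [← Set.pi_univ_Icc, volume_pi, Measure.restrict_pi_pi]
  exact integral_fintype_prod_eq_prod _

theorem abs_prod_le_one {a : ι → ℝ} (h : ∀ i, |a i| ≤ 1) : |∏ i, a i| ≤ 1 := by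
  rw [Finset.abs_prod]
  exact Finset.prod_le_one (fun _ _ => abs_nonneg _) fun i _ => h i

/-- The difference between the number of the first `N` points of `x` in `[0,t)` and its expected
value. -/
noncomputable def countDiscrepancy (x : ℕ → ι → ℝ) (N : ℕ) (t : ι → ℝ) : ℝ :=
  ∑ n ∈ Finset.range N, ∏ i, (Set.Ico 0 (t i)).indicator (fun _ => (1 : ℝ)) (x n i) - N * ∏ i, t i

theorem measurable_countDiscrepancy (x : ℕ → ι → ℝ) (N : ℕ) :
    Measurable (countDiscrepancy x N) := by
  unfold countDiscrepancy
  refine Measurable.sub (Finset.measurable_fun_sum _ fun n _ => Finset.measurable_fun_prod _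
    fun i _ => (measurable_indicator_Ico _).comp (measurable_pi_apply i)) ?_
  exact (Finset.measurable_fun_prod _ fun i _ => measurable_pi_apply i).const_mul _

theorem abs_countDiscrepancy_le (x : ℕ → ι → ℝ) (N : ℕ) {t : ι → ℝ}
    (ht : t ∈ Set.Icc (0 : ι → ℝ) 1) : |countDiscrepancy x N t| ≤ 2 * N := by
  have h1 : |∑ n ∈ Finset.range N, ∏ i, (Set.Ico 0 (t i)).indicator (fun _ => (1 : ℝ)) (x n i)| ≤
      N := by
    refine (Finset.abs_sum_le_sum_abs _ _).trans ((Finset.sum_le_sum fun n _ =>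
      abs_prod_le_one fun i => abs_indicator_one_le _ _).trans ?_)
    simp
  have h2 : |(N : ℝ) * ∏ i, t i| ≤ N := by
    rw [abs_mul, Nat.abs_cast]
    exact mul_le_of_le_one_right (Nat.cast_nonneg _)
      (abs_prod_le_one (abs_apply_le_one_of_mem_Icc ht))
  exact (abs_sub _ _).trans (by linarith)

/-- The product Haar function of the box with levels `ρ`, spatial position `k.1` and temporal
position `k.2`; the temporal side of the box has length `2 ^ (∑ i, ρ i - 1)`. -/
noncomputable def haarBox (ρ : ι → ℕ) (k : (ι → ℕ) × ℕ) (τ : ℕ) (t : ι → ℝ) : ℝ :=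
  haarSign k.2 (τ / 2 ^ (∑ i, ρ i - 2)) * ∏ i, haar (ρ i) (k.1 i) (t i)

theorem measurable_haarBox (ρ : ι → ℕ) (k : (ι → ℕ) × ℕ) (τ : ℕ) : Measurable (haarBox ρ k τ) :=
  (Finset.measurable_fun_prod _ fun i _ =>
    (measurable_haar _ _).comp (measurable_pi_apply i)).const_mul _

theorem abs_haarBox_le (ρ : ι → ℕ) (k : (ι → ℕ) × ℕ) (τ : ℕ) (t : ι → ℝ) :
    |haarBox ρ k τ t| ≤ 1 := by
  rw [haarBox, abs_mul]
  exact mul_le_one₀ (abs_haarSign_le _ _) (abs_nonneg _)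
    (abs_prod_le_one fun i => abs_haar_le _ _ _)

/-- The position of the box with levels `ρ` that contains the point `(x, n)`. -/
noncomputable def boxPosition (ρ : ι → ℕ) (x : ℕ → ι → ℝ) (n : ℕ) : (ι → ℕ) × ℕ :=
  (fun i => ⌊x n i * 2 ^ ρ i⌋₊, n / (2 * 2 ^ (∑ i, ρ i - 2)))

/-- The `2 ^ m` times split into `2 ^ (m + 1 - S)` temporal sides of two halves each. The hypotheses
make both natural subtractions genuine. -/
theorem two_mul_two_pow_mul_two_pow {m S : ℕ} (h2 : 2 ≤ S) (hm : S ≤ m + 1) :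
    2 * 2 ^ (S - 2) * 2 ^ (m + 1 - S) = 2 ^ m := by
  rw [← pow_succ', ← pow_add]
  congr 1
  omega

/-- Temporal length `2 ^ (S - 1)` times spatial volume `2 ^ (-S)`, where `S = ∑ i, ρ i`. -/
theorem sum_integral_haarBox_mul_self {ρ : ι → ℕ} {k : (ι → ℕ) × ℕ} {m : ℕ}
    (h2 : 2 ≤ ∑ i, ρ i) (hm : ∑ i, ρ i ≤ m + 1) (hk1 : ∀ i, k.1 i < 2 ^ ρ i)
    (hk2 : k.2 < 2 ^ (m + 1 - ∑ i, ρ i)) :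
    ∑ τ ∈ Finset.range (2 ^ m), ∫ t in Set.Icc (0 : ι → ℝ) 1, haarBox ρ k τ t * haarBox ρ k τ t =
      1 / 2 := by
  have h1 : ∀ τ, ∫ t in Set.Icc (0 : ι → ℝ) 1, haarBox ρ k τ t * haarBox ρ k τ t =
      haarSign k.2 (τ / 2 ^ (∑ i, ρ i - 2)) * haarSign k.2 (τ / 2 ^ (∑ i, ρ i - 2)) *
        ∏ i, (1 / 2 ^ ρ i : ℝ) := by
    intro τ
    simp only [haarBox, mul_mul_mul_comm, ← Finset.prod_mul_distrib]
    rw [integral_const_mul, integral_Icc_pi_prod fun i x => haar (ρ i) (k.1 i) x * haar (ρ i) (k.1 i) x]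
    simp_rw [fun i => integral_haar_mul_self (hk1 i)]
  simp_rw [h1]
  rw [← Finset.sum_mul, ← two_mul_two_pow_mul_two_pow h2 hm,
    sum_haarSign_mul_self (by positivity) hk2, Finset.prod_div_distrib, Finset.prod_const_one,
    Finset.prod_pow_eq_pow_sum]
  obtain ⟨e, he⟩ := Nat.exists_eq_add_of_le h2
  rw [he, Nat.add_sub_cancel_left, pow_add]
  push_cast
  field_simp

/-- A differing spatial factor makes the integral vanish. Otherwise the levels agree, hence so does
the time scale, and the temporal supports are disjoint. -/
theorem integral_haarBox_mul_of_ne {ρ ρ' : ι → ℕ} {k k' : (ι → ℕ) × ℕ}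
    (hk : ∀ i, k.1 i < 2 ^ ρ i) (hk' : ∀ i, k'.1 i < 2 ^ ρ' i) (hne : ρ ≠ ρ' ∨ k ≠ k') (τ : ℕ) :
    ∫ t in Set.Icc (0 : ι → ℝ) 1, haarBox ρ k τ t * haarBox ρ' k' τ t = 0 := by
  simp only [haarBox, mul_mul_mul_comm, ← Finset.prod_mul_distrib]
  rw [integral_const_mul,
    integral_Icc_pi_prod fun i x => haar (ρ i) (k.1 i) x * haar (ρ' i) (k'.1 i) x]
  by_cases h : ∃ i, ρ i ≠ ρ' i ∨ k.1 i ≠ k'.1 i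
  · obtain ⟨i, hi⟩ := h
    rw [Finset.prod_eq_zero (Finset.mem_univ i)
      (integral_haar_mul_haar_of_ne (hk i) (hk' i) hi), mul_zero]
  · push Not at h
    have h1 : ρ = ρ' := funext fun i => (h i).1
    have h2 : k.1 = k'.1 := funext fun i => (h i).2
    have h3 : k.2 ≠ k'.2 := fun h3 => (hne.resolve_left fun h => h h1) (Prod.ext h2 h3)
    rw [h1, haarSign_mul_of_ne h3, zero_mul]

theorem integral_haarBox_mul_countDiscrepancy (ρ : ι → ℕ) (k : (ι → ℕ) × ℕ) (x : ℕ → ι → ℝ)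
    {τ T : ℕ} (hτ : τ ≤ T) :
    ∫ t in Set.Icc (0 : ι → ℝ) 1, haarBox ρ k τ t * countDiscrepancy x τ t =
      ∑ n ∈ Finset.range T, haarSign k.2 (τ / 2 ^ (∑ i, ρ i - 2)) * (if n < τ then 1 else 0) *
        ∏ i, (∫ t in Set.Icc (0 : ℝ) 1, haar (ρ i) (k.1 i) t *
          (Set.Ico 0 t).indicator (fun _ => (1 : ℝ)) (x n i)) -
      haarSign k.2 (τ / 2 ^ (∑ i, ρ i - 2)) * τ *
        ∏ i, ∫ t in Set.Icc (0 : ℝ) 1, haar (ρ i) (k.1 i) t * t := by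
  set S := haarSign k.2 (τ / 2 ^ (∑ i, ρ i - 2)) with hS
  set f : ℕ → ι → ℝ → ℝ := fun n i t =>
    haar (ρ i) (k.1 i) t * (Set.Ico 0 t).indicator (fun _ => (1 : ℝ)) (x n i) with hf
  have h1 : ∀ t : ι → ℝ, haarBox ρ k τ t * countDiscrepancy x τ t =
      ∑ n ∈ Finset.range T, S * (if n < τ then 1 else 0) * ∏ i, f n i (t i) -
        S * τ * ∏ i, haar (ρ i) (k.1 i) (t i) * t i := by
    intro t
    -- A range of summation independent of `τ` allows the sums over `n` and `τ` to be interchanged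
    -- later.
    have h2 : ∑ n ∈ Finset.range τ,
        ∏ i, (Set.Ico 0 (t i)).indicator (fun _ => (1 : ℝ)) (x n i) =
        ∑ n ∈ Finset.range T, (if n < τ then 1 else 0) *
          ∏ i, (Set.Ico 0 (t i)).indicator (fun _ => (1 : ℝ)) (x n i) := by
      simp_rw [ite_mul, one_mul, zero_mul]
      rw [← Finset.sum_filter]
      congr 1
      ext n
      simp only [Finset.mem_range, Finset.mem_filter]
      omega
    rw [haarBox, ← hS, countDiscrepancy, h2, mul_sub, Finset.mul_sum]
    simp only [hf, Finset.prod_mul_distrib]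
    congr 1
    · exact Finset.sum_congr rfl fun n _ => by ring
    · ring
  have hfi : ∀ n, IntegrableOn (fun t : ι → ℝ => ∏ i, f n i (t i)) (Set.Icc 0 1) := fun n =>
    integrableOn_Icc_pi (Finset.measurable_fun_prod _ fun i _ =>
      ((measurable_haar _ _).mul (measurable_indicator_Ico _)).comp (measurable_pi_apply i)) (C := 1)
      fun t _ => abs_prod_le_one fun i => by
        rw [hf, abs_mul]
        exact mul_le_one₀ (abs_haar_le _ _ _) (abs_nonneg _) (abs_indicator_one_le _ _)
  have hgi : IntegrableOn (fun t : ι → ℝ => ∏ i, haar (ρ i) (k.1 i) (t i) * t i) (Set.Icc 0 1) :=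
    integrableOn_Icc_pi (Finset.measurable_fun_prod _ fun i _ =>
      ((measurable_haar _ _).comp (measurable_pi_apply i)).mul (measurable_pi_apply i)) (C := 1)
      fun t ht => abs_prod_le_one fun i => by
        rw [abs_mul]
        exact mul_le_one₀ (abs_haar_le _ _ _) (abs_nonneg _) (abs_apply_le_one_of_mem_Icc ht i)
  simp_rw [h1]
  rw [integral_sub (integrable_finsetSum _ fun n _ => (hfi n).const_mul _) (hgi.const_mul _),
    integral_finsetSum _ fun n _ => (hfi n).const_mul _, integral_const_mul,
    integral_Icc_pi_prod fun i t => haar (ρ i) (k.1 i) t * t]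
  congr 1
  refine Finset.sum_congr rfl fun n _ => ?_
  rw [integral_const_mul, integral_Icc_pi_prod]

/-- The inner product of the discrepancy function with a Haar function whose box contains no
point. -/
theorem sum_integral_haarBox_mul_countDiscrepancy {ρ : ι → ℕ} {k : (ι → ℕ) × ℕ} {m : ℕ}
    {x : ℕ → ι → ℝ} (h2 : 2 ≤ ∑ i, ρ i) (hm : ∑ i, ρ i ≤ m + 1) (hk1 : ∀ i, k.1 i < 2 ^ ρ i)
    (hk2 : k.2 < 2 ^ (m + 1 - ∑ i, ρ i)) (hempty : ∀ n < 2 ^ m, boxPosition ρ x n ≠ k) :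
    ∑ τ ∈ Finset.range (2 ^ m), ∫ t in Set.Icc (0 : ι → ℝ) 1,
      haarBox ρ k τ t * countDiscrepancy x τ t =
        (-1) ^ Fintype.card ι * (1 / 4 ^ (Fintype.card ι + 2)) := by
  rw [Finset.sum_congr rfl fun τ hτ =>
    integral_haarBox_mul_countDiscrepancy ρ k x (Finset.mem_range.1 hτ).le]
  rw [Finset.sum_sub_distrib, Finset.sum_comm]
  simp_rw [← Finset.sum_mul]
  have hT := two_mul_two_pow_mul_two_pow h2 hm
  have h3 : ∑ n ∈ Finset.range (2 ^ m), (∑ τ ∈ Finset.range (2 ^ m),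
      haarSign k.2 (τ / 2 ^ (∑ i, ρ i - 2)) * (if n < τ then (1 : ℝ) else 0)) *
        ∏ i, (∫ t in Set.Icc (0 : ℝ) 1, haar (ρ i) (k.1 i) t *
          (Set.Ico 0 t).indicator (fun _ => (1 : ℝ)) (x n i)) = 0 := by
    refine Finset.sum_eq_zero fun n hn => ?_
    -- Each point misses the empty box either in time or in some spatial coordinate, and the
    -- corresponding factor is zero.
    by_cases h : n / (2 * 2 ^ (∑ i, ρ i - 2)) = k.2
    · have h4 : ∃ i, ⌊x n i * 2 ^ ρ i⌋₊ ≠ k.1 i := by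
        by_contra h5
        push Not at h5
        exact hempty n (Finset.mem_range.1 hn) (Prod.ext (funext h5) h)
      obtain ⟨i, hi⟩ := h4
      rw [Finset.prod_eq_zero (Finset.mem_univ i) (integral_haar_mul_indicator (hk1 i) hi), mul_zero]
    · rw [← hT, sum_haarSign_mul_eq_zero (by positivity) hk2 h, zero_mul]
  -- Only the volume term is left: `4 ^ (S - 2)` from time against `4 ^ (-S)` from space, so the
  -- result does not depend on the shape of the box.
  rw [h3, ← hT, sum_haarSign_mul_id (by positivity) hk2]
  simp_rw [fun i => integral_haar_mul_id (hk1 i)]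
  rw [Finset.prod_neg, Finset.prod_div_distrib, Finset.prod_const_one, Finset.prod_pow_eq_pow_sum,
    Finset.sum_add_distrib]
  obtain ⟨e, he⟩ := Nat.exists_eq_add_of_le h2
  have h4 : ((2 : ℝ) ^ e) ^ 2 = 4 ^ e := by rw [← pow_mul, mul_comm, pow_mul]; norm_num
  rw [he, Nat.add_sub_cancel_left]
  push_cast
  rw [h4]
  simp only [Finset.sum_const, Finset.card_univ, smul_eq_mul, mul_one]
  rw [show 2 + e + Fintype.card ι = e + (Fintype.card ι + 2) by ring, pow_add 4 e]
  field_simp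
  ring

/-- There are `2 ^ (m + 1)` boxes, and `2 ^ m` points occupy at most `2 ^ m` of them. -/
theorem card_filter_boxes_ge [DecidableEq ι] {ρ : ι → ℕ} {m : ℕ} (hm : ∑ i, ρ i ≤ m + 1)
    (x : ℕ → ι → ℝ) :
    2 ^ m ≤ (((Fintype.piFinset fun i => Finset.range (2 ^ ρ i)) ×ˢ
      Finset.range (2 ^ (m + 1 - ∑ i, ρ i))) \
        (Finset.range (2 ^ m)).image (boxPosition ρ x)).card := by
  have h1 := Finset.le_card_sdiff ((Finset.range (2 ^ m)).image (boxPosition ρ x))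
    ((Fintype.piFinset fun i => Finset.range (2 ^ ρ i)) ×ˢ Finset.range (2 ^ (m + 1 - ∑ i, ρ i)))
  have h2 : ((Finset.range (2 ^ m)).image (boxPosition ρ x)).card ≤ 2 ^ m :=
    Finset.card_image_le.trans (Finset.card_range _).le
  rw [Finset.card_product, Fintype.card_piFinset, Finset.card_range] at h1
  simp only [Finset.card_range] at h1
  rw [Finset.prod_pow_eq_pow_sum, ← pow_add, Nat.add_sub_cancel' hm, pow_succ] at h1
  omega

/-- **Roth's lower bound**, for the sequence version of the discrepancy, averaged over the number
of points. -/
theorem le_sum_integral_sq_countDiscrepancy [Nonempty ι] (x : ℕ → ι → ℝ) {m q : ℕ}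
    (hq : Fintype.card ι * (q + 1) ≤ m + 1) :
    2 * ((q : ℝ) ^ Fintype.card ι * 2 ^ m) * (1 / 16 ^ (Fintype.card ι + 2)) ≤
      ∑ τ ∈ Finset.range (2 ^ m), ∫ t in Set.Icc (0 : ι → ℝ) 1, countDiscrepancy x τ t ^ 2 := by
  classical
  -- There are `q` levels per coordinate. The lower end `2` keeps half the temporal side integral,
  -- and the upper end `q + 1` lets it fit into `2 ^ m` by `hq`.
  set shapes : Finset (ι → ℕ) := Fintype.piFinset fun _ => Finset.Ico 2 (q + 2) with hshapes
  set cells : (ι → ℕ) → Finset ((ι → ℕ) × ℕ) := fun ρ =>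
    ((Fintype.piFinset fun i => Finset.range (2 ^ ρ i)) ×ˢ
      Finset.range (2 ^ (m + 1 - ∑ i, ρ i))) \
        (Finset.range (2 ^ m)).image (boxPosition ρ x) with hcells
  have hsum : ∀ ρ ∈ shapes, 2 ≤ ∑ i, ρ i ∧ ∑ i, ρ i ≤ m + 1 := by
    intro ρ hρ
    have h1 : ∀ i, 2 ≤ ρ i ∧ ρ i < q + 2 := fun i =>
      Finset.mem_Ico.1 (Fintype.mem_piFinset.1 hρ i)
    constructor
    · obtain ⟨i⟩ := ‹Nonempty ι›
      exact (h1 i).1.trans (Finset.single_le_sum (f := ρ) (fun _ _ => Nat.zero_le _)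
        (Finset.mem_univ i))
    · refine le_trans ?_ hq
      calc ∑ i, ρ i ≤ ∑ _i : ι, (q + 1) := Finset.sum_le_sum fun i _ => by have := (h1 i).2; omega
        _ = _ := by simp
  have hcell : ∀ ρ, ∀ k ∈ cells ρ, (∀ i, k.1 i < 2 ^ ρ i) ∧ k.2 < 2 ^ (m + 1 - ∑ i, ρ i) ∧
      ∀ n < 2 ^ m, boxPosition ρ x n ≠ k := by
    intro ρ k hk
    obtain ⟨h1, h2⟩ := Finset.mem_sdiff.1 hk
    obtain ⟨h3, h4⟩ := Finset.mem_product.1 h1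
    refine ⟨fun i => Finset.mem_range.1 (Fintype.mem_piFinset.1 h3 i), Finset.mem_range.1 h4,
      fun n hn h => h2 (Finset.mem_image.2 ⟨n, Finset.mem_range.2 hn, h⟩)⟩
  set E : Finset (Σ _ : ι → ℕ, (ι → ℕ) × ℕ) := shapes.sigma cells with hE
  have hbessel := two_mul_card_mul_sq_le (μ := volume.restrict (Set.Icc (0 : ι → ℝ) 1)) E (2 ^ m)
    (countDiscrepancy x) (fun R => haarBox R.1 R.2)
    (ε := (-1) ^ Fintype.card ι * (1 / 4 ^ (Fintype.card ι + 2)))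
    (fun τ => integrableOn_Icc_pi ((measurable_countDiscrepancy x τ).pow_const 2)
      (C := (2 * τ) ^ 2) fun t ht => by
        rw [abs_pow]
        exact pow_le_pow_left₀ (abs_nonneg _) (abs_countDiscrepancy_le x τ ht) 2)
    (fun R _ τ => integrableOn_Icc_pi
      ((measurable_haarBox R.1 R.2 τ).mul (measurable_countDiscrepancy x τ)) (C := 1 * (2 * τ))
      fun t ht => by
        rw [abs_mul]
        exact mul_le_mul (abs_haarBox_le _ _ _ _) (abs_countDiscrepancy_le x τ ht) (abs_nonneg _)
          zero_le_one)
    (fun R _ R' _ τ => integrableOn_Icc_pi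
      ((measurable_haarBox R.1 R.2 τ).mul (measurable_haarBox R'.1 R'.2 τ)) (C := 1)
      fun t _ => by
        rw [abs_mul]
        exact mul_le_one₀ (abs_haarBox_le _ _ _ _) (abs_nonneg _) (abs_haarBox_le _ _ _ _))
    (fun R hR => by
      obtain ⟨h1, h2⟩ := Finset.mem_sigma.1 hR
      obtain ⟨h3, h4, h5⟩ := hcell _ _ h2
      exact sum_integral_haarBox_mul_countDiscrepancy (hsum _ h1).1 (hsum _ h1).2 h3 h4 h5)
    (fun R hR R' hR' => by
      obtain ⟨h1, h2⟩ := Finset.mem_sigma.1 hR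
      obtain ⟨h3, h4, -⟩ := hcell _ _ h2
      obtain ⟨h1', h2'⟩ := Finset.mem_sigma.1 hR'
      obtain ⟨h3', h4', -⟩ := hcell _ _ h2'
      split_ifs with h
      · subst h
        exact sum_integral_haarBox_mul_self (hsum _ h1).1 (hsum _ h1).2 h3 h4
      · refine Finset.sum_eq_zero fun τ _ => integral_haarBox_mul_of_ne h3 h3' ?_ τ
        by_contra h5
        push Not at h5
        exact h (Sigma.ext h5.1 (heq_of_eq h5.2)))
  refine le_trans ?_ hbessel
  have hcard : (q : ℝ) ^ Fintype.card ι * 2 ^ m ≤ E.card := by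
    have : q ^ Fintype.card ι * 2 ^ m ≤ E.card := by
      rw [hE, Finset.card_sigma]
      calc q ^ Fintype.card ι * 2 ^ m = ∑ ρ ∈ shapes, 2 ^ m := by
            rw [Finset.sum_const, hshapes, Fintype.card_piFinset]
            simp
        _ ≤ _ := Finset.sum_le_sum fun ρ hρ => card_filter_boxes_ge (hsum ρ hρ).2 x
    exact_mod_cast this
  have hsq : ((-1 : ℝ) ^ Fintype.card ι * (1 / 4 ^ (Fintype.card ι + 2))) ^ 2 =
      1 / 16 ^ (Fintype.card ι + 2) := by
    rw [mul_pow, ← pow_mul, mul_comm (Fintype.card ι) 2, pow_mul, neg_one_sq, one_pow, one_mul,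
      div_pow, one_pow, ← pow_mul, mul_comm (Fintype.card ι + 2) 2, pow_mul]
    norm_num
  rw [hsq]
  gcongr

end

/-! ### The `L₂`-discrepancy of shifted Halton sequences -/

theorem sq_l2Discrepancy {s : ℕ} (x : ℕ → Fin s → ℝ) (N : ℕ) :
    l2Discrepancy x N ^ 2 = ∑ u : Finset (Fin s) with u.Nonempty,
      ∫ t in Set.Icc (0 : u → ℝ) 1, localDiscrepancy x N (extendByOne u t) ^ 2 := by
  rw [l2Discrepancy, weightedL2Discrepancy, Real.sq_sqrt]
  · simp only [Finset.prod_const_one, one_mul, sq_abs]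
  · refine Finset.sum_nonneg fun u _ => mul_nonneg (by simp) (integral_nonneg fun t => ?_)
    positivity

theorem extendByOne_mem_Icc {s : ℕ} {u : Finset (Fin s)} {t : u → ℝ}
    (ht : t ∈ Set.Icc (0 : u → ℝ) 1) : extendByOne u t ∈ Set.Icc (0 : Fin s → ℝ) 1 := by
  constructor <;> intro j <;> simp only [extendByOne] <;> split_ifs with h
  · exact ht.1 ⟨j, h⟩
  · exact zero_le_one
  · exact ht.2 ⟨j, h⟩
  · exact le_rfl

theorem measurable_extendByOne {s : ℕ} (u : Finset (Fin s)) : Measurable (extendByOne u) := by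
  refine measurable_pi_lambda _ fun j => ?_
  simp only [extendByOne]
  split_ifs with h
  · exact measurable_pi_apply _
  · exact measurable_const

theorem natCast_mul_localDiscrepancy_eq_countDiscrepancy {s : ℕ} (x : ℕ → Fin s → ℝ) (N : ℕ)
    (t : Fin s → ℝ) : N * localDiscrepancy x N t = countDiscrepancy x N t :=
  natCast_mul_localDiscrepancy x N t

/-- Among the nonnegative terms of the squared discrepancy only the one with all coordinates is
kept. -/
theorem countDiscrepancy_univ_le {s : ℕ} (hs : 1 ≤ s) (x : ℕ → Fin s → ℝ) (N : ℕ) :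
    ∫ t in Set.Icc (0 : ↥(Finset.univ : Finset (Fin s)) → ℝ) 1,
      countDiscrepancy (fun n (i : (Finset.univ : Finset (Fin s))) => x n i) N t ^ 2 ≤
        (N * l2Discrepancy x N) ^ 2 := by
  rw [mul_pow, sq_l2Discrepancy, Finset.mul_sum]
  have hne : (Finset.univ : Finset (Fin s)).Nonempty := ⟨⟨0, hs⟩, Finset.mem_univ _⟩
  refine le_trans (le_of_eq ?_) (Finset.single_le_sum (f := fun u : Finset (Fin s) =>
    (N : ℝ) ^ 2 * ∫ t in Set.Icc (0 : u → ℝ) 1, localDiscrepancy x N (extendByOne u t) ^ 2)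
    (fun u _ => mul_nonneg (sq_nonneg _) (integral_nonneg fun t => sq_nonneg _))
    (Finset.mem_filter.2 ⟨Finset.mem_univ _, hne⟩))
  rw [← integral_const_mul]
  refine setIntegral_congr_fun measurableSet_Icc fun t _ => ?_
  rw [← mul_pow, natCast_mul_localDiscrepancy_eq_countDiscrepancy, countDiscrepancy,
    countDiscrepancy]
  congr 2
  · refine Finset.sum_congr rfl fun n _ => ?_
    exact Fintype.prod_equiv (Equiv.subtypeUnivEquiv Finset.mem_univ) _ _ fun i => by
      simp [extendByOne, Equiv.subtypeUnivEquiv]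
  · congr 1
    exact Fintype.prod_equiv (Equiv.subtypeUnivEquiv Finset.mem_univ) _ _ fun i => by
      simp [extendByOne, Equiv.subtypeUnivEquiv]

theorem abs_localDiscrepancy_le {s : ℕ} (x : ℕ → Fin s → ℝ) {N : ℕ} (hN : 1 ≤ N) {t : Fin s → ℝ}
    (ht : t ∈ Set.Icc (0 : Fin s → ℝ) 1) : |localDiscrepancy x N t| ≤ 2 := by
  have h1 := abs_countDiscrepancy_le x N ht
  rw [← natCast_mul_localDiscrepancy_eq_countDiscrepancy, abs_mul, Nat.abs_cast] at h1
  have h2 : (0 : ℝ) < N := by exact_mod_cast hN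
  nlinarith

section
variable {s : ℕ} (p : Fin s → ℕ) [hp : ∀ j, Fact (p j).Prime]

theorem measurable_localDiscrepancy_shiftedHalton (N : ℕ) (u : Finset (Fin s)) :
    Measurable fun z : (Fin s → ℝ) × (u → ℝ) =>
      localDiscrepancy (shiftedHalton p z.1) N (extendByOne u z.2) := by
  have ht : ∀ i, Measurable fun z : (Fin s → ℝ) × (u → ℝ) => extendByOne u z.2 i := fun i =>
    (measurable_pi_apply i).comp ((measurable_extendByOne u).comp measurable_snd)
  have hx : ∀ n i, Measurable fun z : (Fin s → ℝ) × (u → ℝ) => shiftedHalton p z.1 n i :=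
    fun n i => (measurable_shiftedHalton p n i).comp measurable_fst
  simp only [localDiscrepancy, indicator_pi_eq_prod]
  refine Measurable.sub ((Finset.measurable_fun_sum _ fun n _ => Finset.measurable_fun_prod _
    fun i _ => ?_).const_mul _) (Finset.measurable_fun_prod _ fun i _ => ht i)
  simp only [Set.indicator_apply, Set.mem_Ico]
  refine Measurable.ite ?_ measurable_const measurable_const
  exact (measurableSet_le measurable_const (hx n i)).inter (measurableSet_lt (hx n i) (ht i))

theorem integrable_sq_localDiscrepancy_shiftedHalton {N : ℕ} (hN : 1 ≤ N) (u : Finset (Fin s)) :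
    Integrable (fun z : (Fin s → ℝ) × (u → ℝ) =>
      localDiscrepancy (shiftedHalton p z.1) N (extendByOne u z.2) ^ 2)
      ((volume.restrict (unitCube s)).prod (volume.restrict (Set.Icc (0 : u → ℝ) 1))) := by
  rw [Measure.prod_restrict]
  refine Measure.integrableOn_of_bounded (M := 2 ^ 2) ?_
    ((measurable_localDiscrepancy_shiftedHalton p N u).pow_const 2).aestronglyMeasurable
    (ae_restrict_of_forall_mem ((measurableSet_unitCube s).prod measurableSet_Icc) fun z hz => ?_)
  · rw [Measure.prod_prod, volume_unitCube, one_mul]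
    exact isCompact_Icc.measure_lt_top.ne
  · rw [norm_pow]
    exact pow_le_pow_left₀ (norm_nonneg _)
      (abs_localDiscrepancy_le _ hN (extendByOne_mem_Icc hz.2)) 2

theorem integrableOn_sq_l2Discrepancy_shiftedHalton {N : ℕ} (hN : 1 ≤ N) :
    IntegrableOn (fun σ => l2Discrepancy (shiftedHalton p σ) N ^ 2) (unitCube s) := by
  simp_rw [sq_l2Discrepancy]
  exact integrable_finsetSum _ fun u _ =>
    (integrable_sq_localDiscrepancy_shiftedHalton p hN u).integral_prod_left

theorem sq_rmsL2Discrepancy (N : ℕ) :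
    rmsL2Discrepancy p N ^ 2 = ∫ σ in unitCube s, l2Discrepancy (shiftedHalton p σ) N ^ 2 := by
  rw [rmsL2Discrepancy, Real.sq_sqrt (integral_nonneg fun σ => sq_nonneg _)]

variable {p}

/-- Fubini's theorem moves the mean over the shift inside, where the bound is uniform in `t`,
including coordinates equal to `1`. There are at most `2 ^ s` sets `u`. -/
theorem sq_rmsL2Discrepancy_le (hinj : Function.Injective p) {N G : ℕ} (hN : 1 ≤ N)
    (hG : N ^ 2 ≤ 2 ^ G) :
    (N * rmsL2Discrepancy p N) ^ 2 ≤
      2 ^ s * (2 * (((G : ℝ) + 1) ^ s * (∏ j, (p j : ℝ)) ^ 2) + 8 * s ^ 2) := by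
  set K : ℝ := 2 * (((G : ℝ) + 1) ^ s * (∏ j, (p j : ℝ)) ^ 2) + 8 * s ^ 2 with hK
  have hK0 : 0 ≤ K := by positivity
  have hI := fun u : Finset (Fin s) => integrable_sq_localDiscrepancy_shiftedHalton p hN u
  have hu : ∀ u : Finset (Fin s), (N : ℝ) ^ 2 * ∫ σ in unitCube s, ∫ t in Set.Icc (0 : u → ℝ) 1,
      localDiscrepancy (shiftedHalton p σ) N (extendByOne u t) ^ 2 ≤ K := by
    intro u
    rw [integral_integral_swap (hI u), ← integral_const_mul]
    have hvol : volume.real (Set.Icc (0 : u → ℝ) 1) = 1 := by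
      simp [Measure.real, Real.volume_Icc_pi]
    have hle : ∀ t ∈ Set.Icc (0 : u → ℝ) 1, ‖(N : ℝ) ^ 2 * ∫ σ in unitCube s,
        localDiscrepancy (shiftedHalton p σ) N (extendByOne u t) ^ 2‖ ≤ K := by
      intro t ht
      have ht' := extendByOne_mem_Icc ht
      rw [Real.norm_of_nonneg (mul_nonneg (sq_nonneg _) (integral_nonneg fun σ => sq_nonneg _)),
        ← integral_const_mul]
      simp_rw [← mul_pow]
      exact integral_sq_localDiscrepancy_le hinj ht'.1 ht'.2 hG
    have h := norm_setIntegral_le_of_norm_le_const (μ := volume) isCompact_Icc.measure_lt_top hle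
    rw [hvol, mul_one] at h
    exact (le_abs_self _).trans h
  rw [mul_pow, sq_rmsL2Discrepancy]
  simp_rw [sq_l2Discrepancy]
  rw [integral_finsetSum _ fun u _ => (hI u).integral_prod_left, Finset.mul_sum]
  refine (Finset.sum_le_sum fun u _ => hu u).trans ?_
  rw [Finset.sum_const, nsmul_eq_mul]
  refine mul_le_mul_of_nonneg_right ?_ hK0
  have : (Finset.univ.filter fun u : Finset (Fin s) => u.Nonempty).card ≤ 2 ^ s :=
    (Finset.card_filter_le _ _).trans (by simp)
  exact_mod_cast this

/-! ### From digits to logarithms, and the choice of a good shift. -/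

theorem sq_rpow_half_div {L : ℝ} (hL : 0 ≤ L) (s N : ℕ) :
    (L ^ ((s : ℝ) / 2) / N) ^ 2 = L ^ s / (N : ℝ) ^ 2 := by
  rw [div_pow, ← Real.rpow_natCast, ← Real.rpow_mul hL]
  simp

theorem exists_sq_rmsL2Discrepancy_le (hinj : Function.Injective p) :
    ∃ C : ℝ, 0 < C ∧ ∀ N : ℕ, 2 ≤ N →
      rmsL2Discrepancy p N ^ 2 ≤ (C * (Real.log N ^ ((s : ℝ) / 2) / N)) ^ 2 := by
  set B : ℝ := ∏ j, (p j : ℝ) with hB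
  have hB0 : 0 < B := Finset.prod_pos fun j _ => by exact_mod_cast (hp j).1.pos
  -- `8 ^ s` comes from `G + 1 ≤ 8 * log N`, and `2 ^ s` from `1 ≤ (2 * log N) ^ s`.
  set A : ℝ := 2 ^ s * (2 * (8 ^ s * B ^ 2) + 8 * s ^ 2 * 2 ^ s) with hA
  have hA0 : 0 < A := by positivity
  refine ⟨√A, Real.sqrt_pos.2 hA0, fun N hN => ?_⟩
  have hN0 : (0 : ℝ) < N := by exact_mod_cast (by omega : 0 < N)
  have hlog2 := Real.log_two_gt_d9
  have hL : Real.log 2 ≤ Real.log N := Real.log_le_log two_pos (by exact_mod_cast hN)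
  have hL0 : 0 ≤ Real.log N := by linarith
  rw [mul_pow, Real.sq_sqrt hA0.le, sq_rpow_half_div hL0, ← mul_div_assoc,
    le_div_iff₀ (by positivity), mul_comm, ← mul_pow]
  have hG : N ^ 2 ≤ 2 ^ (2 * (Nat.log 2 N + 1)) := by
    rw [mul_comm, pow_mul]
    exact Nat.pow_le_pow_left (Nat.lt_pow_succ_log_self one_lt_two N).le 2
  refine (sq_rmsL2Discrepancy_le hinj (by omega) hG).trans ?_
  have h1 : (Nat.log 2 N : ℝ) * Real.log 2 ≤ Real.log N := by
    rw [← Real.log_pow]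
    exact Real.log_le_log (by positivity) (by exact_mod_cast Nat.pow_log_le_self 2 (by omega))
  -- The left side is `2 * Nat.log 2 N + 3`, at most `(5 / log 2) * log N` because `log 2 ≤ log N`;
  -- and `5 / log 2 < 8`.
  have h2 : ((2 * (Nat.log 2 N + 1) : ℕ) : ℝ) + 1 ≤ 8 * Real.log N := by
    have h3 : (0 : ℝ) ≤ Nat.log 2 N := Nat.cast_nonneg _
    push_cast
    nlinarith
  have h4 : (1 : ℝ) ≤ 2 ^ s * Real.log N ^ s := by
    rw [← mul_pow]
    exact one_le_pow₀ (by linarith)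
  calc (2 : ℝ) ^ s * (2 * ((((2 * (Nat.log 2 N + 1) : ℕ) : ℝ) + 1) ^ s * B ^ 2) + 8 * s ^ 2)
      ≤ 2 ^ s * (2 * ((8 * Real.log N) ^ s * B ^ 2) + 8 * s ^ 2 * (2 ^ s * Real.log N ^ s)) := by
        have h5 : (8 : ℝ) * s ^ 2 ≤ 8 * s ^ 2 * (2 ^ s * Real.log N ^ s) :=
          le_mul_of_one_le_right (by positivity) h4
        refine mul_le_mul_of_nonneg_left (add_le_add ?_ h5) (by positivity)
        gcongr
    _ = A * Real.log N ^ s := by rw [hA, mul_pow 8]; ring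

/-- On a set of measure one, some value does not exceed the mean. -/
theorem exists_l2Discrepancy_le_rmsL2Discrepancy {N : ℕ} (hN : 1 ≤ N) :
    ∃ σ ∈ unitCube s, l2Discrepancy (shiftedHalton p σ) N ^ 2 ≤ rmsL2Discrepancy p N ^ 2 := by
  obtain ⟨σ, hσ, h⟩ := exists_le_setAverage (μ := volume) (s := unitCube s)
    (by simp [volume_unitCube]) (by simp [volume_unitCube])
    (integrableOn_sq_l2Discrepancy_shiftedHalton p hN)
  refine ⟨σ, hσ, h.trans_eq ?_⟩
  rw [setAverage_eq, volume_real_unitCube, inv_one, one_smul, sq_rmsL2Discrepancy]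

end

/-! ### Lower bounds for infinitely many numbers of points -/

theorem le_sum_sq_l2Discrepancy {s : ℕ} (hs : 1 ≤ s) (x : ℕ → Fin s → ℝ) {m q : ℕ}
    (hq : s * (q + 1) ≤ m + 1) :
    2 / 16 ^ (s + 2) * ((q : ℝ) ^ s * 2 ^ m) ≤
      ∑ τ ∈ Finset.range (2 ^ m), (τ * l2Discrepancy x τ) ^ 2 := by
  have : Nonempty (Finset.univ : Finset (Fin s)) := ⟨⟨⟨0, hs⟩, Finset.mem_univ _⟩⟩
  have hcard : Fintype.card (Finset.univ : Finset (Fin s)) = s := by simp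
  have h := le_sum_integral_sq_countDiscrepancy
    (fun n (i : (Finset.univ : Finset (Fin s))) => x n i) (m := m) (q := q) (by rwa [hcard])
  rw [hcard] at h
  refine le_trans (le_of_eq (by ring)) (h.trans ?_)
  exact Finset.sum_le_sum fun τ _ => countDiscrepancy_univ_le hs x τ

/-- Roth's bound has the same constant for every shift, so it survives integration over the shifts.
-/
theorem le_sum_sq_rmsL2Discrepancy {s : ℕ} (hs : 1 ≤ s) (p : Fin s → ℕ) [∀ j, Fact (p j).Prime]
    {m q : ℕ} (hq : s * (q + 1) ≤ m + 1) :
    2 / 16 ^ (s + 2) * ((q : ℝ) ^ s * 2 ^ m) ≤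
      ∑ τ ∈ Finset.range (2 ^ m), (τ * rmsL2Discrepancy p τ) ^ 2 := by
  have hint : ∀ τ : ℕ, IntegrableOn
      (fun σ => (τ * l2Discrepancy (shiftedHalton p σ) τ) ^ 2) (unitCube s) := by
    intro τ
    rcases Nat.eq_zero_or_pos τ with rfl | hτ
    · simp
    · simp_rw [mul_pow]
      exact (integrableOn_sq_l2Discrepancy_shiftedHalton p hτ).const_mul _
  have h1 : ∑ τ ∈ Finset.range (2 ^ m), (τ * rmsL2Discrepancy p τ) ^ 2 =
      ∫ σ in unitCube s, ∑ τ ∈ Finset.range (2 ^ m),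
        (τ * l2Discrepancy (shiftedHalton p σ) τ) ^ 2 := by
    rw [integral_finsetSum _ fun τ _ => hint τ]
    refine Finset.sum_congr rfl fun τ _ => ?_
    simp_rw [mul_pow]
    rw [sq_rmsL2Discrepancy, integral_const_mul]
  rw [h1]
  calc 2 / 16 ^ (s + 2) * ((q : ℝ) ^ s * 2 ^ m)
      = ∫ σ in unitCube s, 2 / 16 ^ (s + 2) * ((q : ℝ) ^ s * 2 ^ m) := by
        rw [setIntegral_const, volume_real_unitCube, one_smul]
    _ ≤ _ := integral_mono (integrableOn_const (by simp [volume_unitCube]))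
        (integrable_finsetSum _ fun τ _ => hint τ) fun σ => le_sum_sq_l2Discrepancy hs _ hq

/-- If the set were finite, its members would contribute a fixed amount `K` to the sum and all other
terms would be at most `c ^ 2 * m ^ s`. The choice of `c` makes these account for at most half of
the lower bound. -/
theorem infinite_setOf_le_of_le_sum {s : ℕ} (hs : 1 ≤ s) {κ c : ℝ} (hκ : 0 < κ)
    (hc : c ^ 2 * (2 * s) ^ s = κ / 2) {a : ℕ → ℝ} (ha : ∀ N, 0 ≤ a N)
    (h : ∀ m q : ℕ, s * (q + 1) ≤ m + 1 →
      κ * ((q : ℝ) ^ s * 2 ^ m) ≤ ∑ τ ∈ Finset.range (2 ^ m), (τ * a τ) ^ 2) :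
    {N : ℕ | c * (Real.log N ^ ((s : ℝ) / 2) / N) ≤ a N}.Infinite := by
  intro hfin
  set A := hfin.toFinset with hA
  set K : ℝ := ∑ τ ∈ A, (τ * a τ) ^ 2 with hK
  -- `q` is so large that the other half of the lower bound exceeds `K`.
  obtain ⟨q, hq⟩ := exists_nat_gt (max 1 (K / (κ / 2)))
  have hq1 : (1 : ℝ) < q := (le_max_left _ _).trans_lt hq
  have hqK : K < κ / 2 * q := by
    have := (le_max_right _ _).trans_lt hq
    rwa [div_lt_iff₀ (by positivity), mul_comm] at this
  set m := s * (q + 1) with hm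
  have hmq : (m : ℝ) ≤ 2 * s * q := by
    have : (0 : ℝ) ≤ s := Nat.cast_nonneg _
    rw [hm]; push_cast; nlinarith
  have hterm : ∀ τ ∈ Finset.range (2 ^ m), τ ∉ A → (τ * a τ) ^ 2 ≤ c ^ 2 * (m : ℝ) ^ s := by
    intro τ hτ hτA
    rcases Nat.eq_zero_or_pos τ with rfl | hpos
    · rw [Nat.cast_zero, zero_mul, zero_pow two_ne_zero]
      positivity
    have hτ0 : (0 : ℝ) < τ := by exact_mod_cast hpos
    have h1 : a τ ≤ c * (Real.log τ ^ ((s : ℝ) / 2) / τ) := by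
      by_contra h2
      exact hτA (hfin.mem_toFinset.2 (not_le.1 h2).le)
    have hL0 : 0 ≤ Real.log τ := Real.log_nonneg (by exact_mod_cast hpos)
    have hLm : Real.log τ ≤ m := by
      have h3 : Real.log τ ≤ Real.log ((2 : ℝ) ^ m) :=
        Real.log_le_log hτ0 (by exact_mod_cast (Finset.mem_range.1 hτ).le)
      rw [Real.log_pow] at h3
      have h4 := Real.log_two_lt_d9
      exact h3.trans (mul_le_of_le_one_right (Nat.cast_nonneg _) (by linarith))
    calc (τ * a τ) ^ 2 = (τ : ℝ) ^ 2 * a τ ^ 2 := mul_pow _ _ _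
      _ ≤ (τ : ℝ) ^ 2 * (c * (Real.log τ ^ ((s : ℝ) / 2) / τ)) ^ 2 := by
          gcongr
          exact ha τ
      _ = c ^ 2 * Real.log τ ^ s := by
          rw [mul_pow, sq_rpow_half_div hL0]
          field_simp
      _ ≤ c ^ 2 * (m : ℝ) ^ s := by gcongr
  have hsum : ∑ τ ∈ Finset.range (2 ^ m), (τ * a τ) ^ 2 ≤ K + 2 ^ m * (c ^ 2 * (m : ℝ) ^ s) := by
    rw [← Finset.sum_filter_add_sum_filter_not _ (fun τ => τ ∈ A)]
    refine add_le_add ?_ ?_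
    · exact Finset.sum_le_sum_of_subset_of_nonneg (fun τ hτ => (Finset.mem_filter.1 hτ).2)
        fun _ _ _ => sq_nonneg _
    · refine (Finset.sum_le_sum fun τ hτ => hterm τ (Finset.mem_filter.1 hτ).1
        (Finset.mem_filter.1 hτ).2).trans ?_
      rw [Finset.sum_const, nsmul_eq_mul]
      gcongr
      exact_mod_cast (Finset.card_filter_le _ _).trans (Finset.card_range _).le
  have h1 := (h m q (Nat.le_succ _)).trans hsum
  have h2 : c ^ 2 * (m : ℝ) ^ s ≤ κ / 2 * (q : ℝ) ^ s := by
    calc c ^ 2 * (m : ℝ) ^ s ≤ c ^ 2 * (2 * s * q) ^ s := by gcongr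
      _ = κ / 2 * (q : ℝ) ^ s := by rw [mul_pow _ (q : ℝ), ← mul_assoc, hc]
  have h3 : (2 : ℝ) ^ m * (c ^ 2 * (m : ℝ) ^ s) ≤ 2 ^ m * (κ / 2 * (q : ℝ) ^ s) := by gcongr
  have h4 : (q : ℝ) ≤ (q : ℝ) ^ s * 2 ^ m := by
    have h5 : (q : ℝ) ≤ (q : ℝ) ^ s := le_self_pow₀ hq1.le (by omega)
    exact h5.trans (le_mul_of_one_le_right (by positivity) (one_le_pow₀ one_le_two))
  have h6 : κ / 2 * q ≤ κ / 2 * ((q : ℝ) ^ s * 2 ^ m) := by gcongr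
  linarith

theorem mainTheorem6 (s : ℕ) (hs : 1 ≤ s) :
    -- the mean square exists, and the upper bounds hold
    (∀ (p : Fin s → ℕ) [∀ j, Fact (p j).Prime], Function.Injective p →
      (∀ N : ℕ, 1 ≤ N →
        IntegrableOn (fun σ => l2Discrepancy (shiftedHalton p σ) N ^ 2) (unitCube s)) ∧
      ∃ C : ℝ, 0 < C ∧ ∀ N : ℕ, 2 ≤ N →
        rmsL2Discrepancy p N ≤ C * (Real.log N ^ ((s : ℝ) / 2) / N) ∧
        ∃ σ ∈ unitCube s,
          l2Discrepancy (shiftedHalton p σ) N ≤ C * (Real.log N ^ ((s : ℝ) / 2) / N)) ∧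
    -- the order of magnitude in `N` is best possible
    ∃ c : ℝ, 0 < c ∧
      (∀ x : ℕ → Fin s → ℝ, (∀ n, x n ∈ unitCube s) →
        {N : ℕ | c * (Real.log N ^ ((s : ℝ) / 2) / N) ≤ l2Discrepancy x N}.Infinite) ∧
      (∀ (p : Fin s → ℕ) [∀ j, Fact (p j).Prime], Function.Injective p →
        {N : ℕ | c * (Real.log N ^ ((s : ℝ) / 2) / N) ≤ rmsL2Discrepancy p N}.Infinite) := by
  refine ⟨fun p _ hinj => ⟨fun N hN => integrableOn_sq_l2Discrepancy_shiftedHalton p hN, ?_⟩, ?_⟩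
  · obtain ⟨C, hC, h⟩ := exists_sq_rmsL2Discrepancy_le hinj
    refine ⟨C, hC, fun N hN => ?_⟩
    have h0 : 0 ≤ C * (Real.log N ^ ((s : ℝ) / 2) / N) := by
      have := Real.log_natCast_nonneg N
      positivity
    refine ⟨le_of_sq_le_sq (h N hN) h0, ?_⟩
    obtain ⟨σ, hσ, hle⟩ := exists_l2Discrepancy_le_rmsL2Discrepancy (p := p) (N := N) (by omega)
    exact ⟨σ, hσ, le_of_sq_le_sq (hle.trans (h N hN)) h0⟩
  · have hs0 : (0 : ℝ) < s := by exact_mod_cast hs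
    have hκ : (0 : ℝ) < 2 / 16 ^ (s + 2) := by positivity
    -- The constant solves `c ^ 2 * (2 * s) ^ s = κ / 2` with `κ = 2 / 16 ^ (s + 2)`, and thus
    -- depends on `s` only.
    have hd : (0 : ℝ) < 2 / 16 ^ (s + 2) / 2 / (2 * s) ^ s := by positivity
    have hc : √(2 / 16 ^ (s + 2) / 2 / (2 * s) ^ s : ℝ) ^ 2 * (2 * s) ^ s =
        2 / 16 ^ (s + 2) / 2 := by
      rw [Real.sq_sqrt hd.le, div_mul_cancel₀ _ (by positivity)]
    refine ⟨√(2 / 16 ^ (s + 2) / 2 / (2 * s) ^ s), Real.sqrt_pos.2 hd, fun x _ => ?_,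
      fun p _ _ => ?_⟩
    · exact infinite_setOf_le_of_le_sum hs hκ hc (fun N => Real.sqrt_nonneg _)
        fun m q hq => le_sum_sq_l2Discrepancy hs x hq
    · exact infinite_setOf_le_of_le_sum hs hκ hc (fun N => Real.sqrt_nonneg _)
        fun m q hq => le_sum_sq_rmsL2Discrepancy hs p hq
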